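/- Let $n\ge 2$, let $M$ be a nonempty smooth $n$-dimensional manifold (Hausdorff, second countable, without boundary), let $b_0,g_0>0$, and let $\Psi=\Psi(s,\bar s)$ be a positive $C^\infty$ function on $(-b_0,b_0)\times(-g_0,g_0)$. For a Riemannian metric $\alpha=\sqrt{a_{ij}(x)y^iy^j}$ and $1$-forms $\beta=b_i(x)y^i$, $\gamma=\gamma_i(x)y^i$ on $M$ (all smooth) put $$F=\alpha\,\Psi(s,\bar s),\quad s=\frac{\beta}{\alpha},\quad \bar s=\frac{\gamma}{\alpha},\qquad b=\|\beta\|_\alpha=\sqrt{a^{ij}b_ib_j},\quad g=\|\gamma\|_\alpha=\sqrt{a^{ij}\gamma_i\gamma_j},\quad \theta=a^{ij}b_i\gamma_j .$$ For a set $A$ of tangent vectors, call $F$ a Finsler metric on $A$ if $F\ge 0$, $F$ is $C^\infty$ on $TM\setminus\{0\}$, $F$ is positively $1$-homogeneous on the fibres, and at every nonzero $y\in T_xM$ with $(x,y)\in A$ the form $$\mathbf g_y(u,v)=\frac12\,\frac{\partial^2}{\partial \sigma\,\partial \tau}\Big[F^2(y+\sigma u+\tau v)\Big]_{\sigma=\tau=0},\qquad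 u,v\in T_xM,$$ is positive definite. A Finsler metric is a Finsler metric on $A=TM$. For real numbers $s,\bar s,b,g,\theta$ put $$\Pi=\Psi-s\Psi_s-\bar s\Psi_{\bar s},\qquad J=\frac{\Psi_{ss}\Psi_{\bar s\bar s}-\Psi_{s\bar s}^2}{\Pi},$$ $$\Gamma=\Pi+(b^2-s^2)\Psi_{ss}+(g^2-\bar s^2)\Psi_{\bar s\bar s}+2(\theta-s\bar s)\Psi_{s\bar s}+\big[(b^2-s^2)(g^2-\bar s^2)-(\theta-s\bar s)^2\big]J,$$ where the last summand is read as $0$ when the bracket vanishes. Call the numbers admissible if $|s|\le b<b_0$, $|\bar s|\le g<g_0$, $\theta-s\bar s\ge 0$ and $(\theta-s\bar s)^2\le (b^2-s^2)(g^2-\bar s^2)$, with equality in the last relation if $n=2$. (Up to the condition $\theta-s\bar s\ge0$ and the bounds $b_0,g_0$, these are exactly the values that $s,\bar s,b,g,\theta$ can take for two covectors and a nonzero vector in dimension $n$.) Consider the condition $(\ast)$ for all admissible $s,\bar s,b,g,\theta$: $\ \Pi>0$ and $\Gamma>0$ if $n\ge3$; $\ \Gamma>0$ if $n=2$. Then: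 (1) $F=\alpha\Psi(\beta/\alpha,\gamma/\alpha)$ is a Finsler metric on $\{(x,y)\in TM\setminus\{0\}:\ \theta-s\bar s\ge0\}$ for every Riemannian metric $\alpha$ and all $1$-forms $\beta,\gamma$ on $M$ with $\|\beta\|_\alpha<b_0$ and $\|\gamma\|_\alpha<g_0$ (at every point of $M$) if and only if $\Psi$ satisfies $(\ast)$. (2) In particular, if $(\ast)$ holds, then $F$ is a Finsler metric for all $\alpha,\beta,\gamma$ with $\|\beta\|_\alpha<b_0$, $\|\gamma\|_\alpha<g_0$ and $\theta-s\bar s\ge0$ for all $(x,y)\in TM\setminus\{0\}$. -/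

import Mathlib

open Set Bundle Manifold
open scoped ContDiff Topology

noncomputable section

namespace ABC

/-! ### Functions of two real variables -/

/-- The partial derivative in the first variable, `Ψ_s`. -/
def dS (Ψ : ℝ → ℝ → ℝ) : ℝ → ℝ → ℝ := fun s s' => deriv (fun u => Ψ u s') s

/-- The partial derivative in the second variable, `Ψ_{s̄}`. -/
def dS' (Ψ : ℝ → ℝ → ℝ) : ℝ → ℝ → ℝ := fun s s' => deriv (fun u => Ψ s u) s'

/-- `Π = Ψ - s Ψ_s - s̄ Ψ_{s̄}`. -/
def bigPi (Ψ : ℝ → ℝ → ℝ) (s s' : ℝ) : ℝ :=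
  Ψ s s' - s * dS Ψ s s' - s' * dS' Ψ s s'

/-- `J = (Ψ_{ss} Ψ_{s̄s̄} - Ψ_{ss̄}²) / Π`. -/
def bigJ (Ψ : ℝ → ℝ → ℝ) (s s' : ℝ) : ℝ :=
  (dS (dS Ψ) s s' * dS' (dS' Ψ) s s' - dS' (dS Ψ) s s' * dS' (dS Ψ) s s') / bigPi Ψ s s'

/-- `Γ = Π + (b² - s²) Ψ_{ss} + (g² - s̄²) Ψ_{s̄s̄} + 2 (θ - s s̄) Ψ_{ss̄}
  + [(b² - s²)(g² - s̄²) - (θ - s s̄)²] J`.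
Whenever the bracket vanishes, the last term is `0`, whatever the denominator of `J` is. -/
def bigGamma (Ψ : ℝ → ℝ → ℝ) (s s' b g θ : ℝ) : ℝ :=
  bigPi Ψ s s' + (b ^ 2 - s ^ 2) * dS (dS Ψ) s s' + (g ^ 2 - s' ^ 2) * dS' (dS' Ψ) s s'
    + 2 * (θ - s * s') * dS' (dS Ψ) s s'
    + ((b ^ 2 - s ^ 2) * (g ^ 2 - s' ^ 2) - (θ - s * s') ^ 2) * bigJ Ψ s s'

/-- The numbers at which the inequalities are required in dimension `n`: `|s| ≤ b < b₀`,
`|s̄| ≤ g < g₀`, `θ - s s̄ ≥ 0`, where `θ` is the inner product of two covectors of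
Euclidean `n`-space of norms `b`, `g` which take the values `s`, `s̄` on a common unit vector.
The last requirement is the inequality of Cauchy and Schwarz for the parts of the two covectors
that are orthogonal to this vector; it is an equality if `n = 2`, because these parts
are then proportional. -/
structure Admissible (n : ℕ) (b₀ g₀ s s' b g θ : ℝ) : Prop where
  abs_s_le : |s| ≤ b
  b_lt : b < b₀
  abs_s'_le : |s'| ≤ g
  g_lt : g < g₀
  nonneg : 0 ≤ θ - s * s'
  cauchy_schwarz : (θ - s * s') ^ 2 ≤ (b ^ 2 - s ^ 2) * (g ^ 2 - s' ^ 2)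
  eq_of_dim_two : n = 2 → (θ - s * s') ^ 2 = (b ^ 2 - s ^ 2) * (g ^ 2 - s' ^ 2)

/-- `Π > 0` and `Γ > 0` if `n ≥ 3`, and `Γ > 0` alone if `n = 2`, at all admissible numbers. -/
def ConvexityCondition (n : ℕ) (b₀ g₀ : ℝ) (Ψ : ℝ → ℝ → ℝ) : Prop :=
  (3 ≤ n → ∀ s s' b g θ : ℝ, Admissible n b₀ g₀ s s' b g θ →
    0 < bigPi Ψ s s' ∧ 0 < bigGamma Ψ s s' b g θ) ∧
  (n = 2 → ∀ s s' b g θ : ℝ, Admissible n b₀ g₀ s s' b g θ →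
    0 < bigGamma Ψ s s' b g θ)

/-! ### Finsler metrics -/

section Manifold

variable {n : ℕ} {M : Type*} [TopologicalSpace M] [ChartedSpace (EuclideanSpace ℝ (Fin n)) M]
  [IsManifold (𝓡 n) ∞ M]

/-- The quadratic form `g_y(u, u)`, where
`g_y(u, v) = (1/2) ∂²/∂s∂t F²(y + s u + t v)` at `s = t = 0`. -/
def fundamentalForm (F : TangentBundle (𝓡 n) M → ℝ) (x : M) (y u v : TangentSpace (𝓡 n) x) : ℝ :=
  (1 / 2) * deriv (fun s : ℝ => deriv (fun t : ℝ => F ⟨x, y + s • u + t • v⟩ ^ 2) 0) 0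

/-- `F` is a nonnegative function on `TM`, smooth off the zero section, positively
`1`-homogeneous, whose fundamental form is positive definite at all nonzero tangent vectors
that belong to `A`. -/
structure IsFinslerMetricOn (F : TangentBundle (𝓡 n) M → ℝ) (A : Set (TangentBundle (𝓡 n) M)) :
    Prop where
  nonneg : ∀ p, 0 ≤ F p
  smooth : ContMDiffOn (𝓡 n).tangent 𝓘(ℝ, ℝ) ∞ F {p | p.2 ≠ 0}
  homogeneous : ∀ (x : M) (y : TangentSpace (𝓡 n) x) (c : ℝ), 0 < c → F ⟨x, c • y⟩ = c * F ⟨x, y⟩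
  posDef : ∀ (x : M) (y : TangentSpace (𝓡 n) x), y ≠ 0 → (⟨x, y⟩ : TangentBundle (𝓡 n) M) ∈ A →
    ∀ u : TangentSpace (𝓡 n) x, u ≠ 0 → 0 < fundamentalForm F x y u u

/-- A Finsler metric on `M`. -/
def IsFinslerMetric (F : TangentBundle (𝓡 n) M → ℝ) : Prop :=
  IsFinslerMetricOn F Set.univ

variable (n M) in
/-- Smooth Riemannian metrics on `M`. -/
abbrev Metric : Type _ :=
  ContMDiffRiemannianMetric (𝓡 n) ∞ (EuclideanSpace ℝ (Fin n))
    (fun x : M => TangentSpace (𝓡 n) x)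

variable (n M) in
/-- Smooth `1`-forms on `M`. -/
abbrev OneForm : Type _ :=
  ContMDiffSection (𝓡 n) (EuclideanSpace ℝ (Fin n) →L[ℝ] ℝ) ∞
    (fun x : M => TangentSpace (𝓡 n) x →L[ℝ] ℝ)

/-- The `i`-th coordinate vector of `T_xM`. -/
def coordVec (x : M) (i : Fin n) : TangentSpace (𝓡 n) x :=
  (EuclideanSpace.single i (1 : ℝ) : EuclideanSpace ℝ (Fin n))

/-- The matrix `(a_{ij})` of the Riemannian metric at `x`. -/
def metricMatrix (a : Metric n M) (x : M) : Matrix (Fin n) (Fin n) ℝ :=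
  Matrix.of fun i j => a.inner x (coordVec x i) (coordVec x j)

/-- `a^{ij} b_i γ_j` at `x`, where `(a^{ij})` is the inverse of `(a_{ij})`. -/
def dualInner (a : Metric n M) (β γ : OneForm n M) (x : M) : ℝ :=
  ∑ i, ∑ j, (metricMatrix a x)⁻¹ i j * β x (coordVec x i) * γ x (coordVec x j)

/-- `‖β‖_α` at `x`. -/
def dualNorm (a : Metric n M) (β : OneForm n M) (x : M) : ℝ :=
  Real.sqrt (dualInner a β β x)

/-- `α = √(a_{ij} yⁱ yʲ)`. -/
def alpha (a : Metric n M) (p : TangentBundle (𝓡 n) M) : ℝ :=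
  Real.sqrt (a.inner p.1 p.2 p.2)

/-- `β / α`. -/
def ratio (a : Metric n M) (β : OneForm n M) (p : TangentBundle (𝓡 n) M) : ℝ :=
  β p.1 p.2 / alpha a p

/-- `F = α Ψ(β/α, γ/α)`. -/
def abcMetric (Ψ : ℝ → ℝ → ℝ) (a : Metric n M) (β γ : OneForm n M) (p : TangentBundle (𝓡 n) M) :
    ℝ :=
  alpha a p * Ψ (ratio a β p) (ratio a γ p)

/-- The tangent vectors at which `θ - s s̄ ≥ 0`. -/
def thetaRegion (a : Metric n M) (β γ : OneForm n M) : Set (TangentBundle (𝓡 n) M) :=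
  {p | 0 ≤ dualInner a β γ p.1 - ratio a β p * ratio a γ p}

end Manifold

end ABC

end

/-!
At a vector `y` of `α`-length one, the fundamental form of `F` is `F_y(u)² + F F_{yy}(u, u)`. The
second derivative of `F` only sees the part `w` of `u` that is `α`-orthogonal to `y`, where
differentiating `F = α Ψ(β/α, γ/α)` twice gives
`F_{yy}(w, w) = Π |w|² + Ψ_{ss} β(w)² + 2 Ψ_{ss̄} β(w) γ(w) + Ψ_{s̄s̄} γ(w)²`
(`half_deriv_deriv_sq`). Adding a multiple of `y` to `w` makes `F_y(u)` vanish, so `F` is strongly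
convex at `y` if and only if this transversal form is positive definite on the orthogonal complement
of `y` (`pos_iff_transversal_pos`, `fundamentalForm_pos_iff`).

The vectors dual to `β` and `γ` have orthogonal parts with squared lengths `b² - s²`, `g² - s̄²` and
inner product `θ - s s̄`. If `n = 2`, the transversal form is `Γ |w|²`. If `n ≥ 3`, it is `Π |w|²`
orthogonally to a plane containing both parts, and on this plane its determinant is `Π Γ`. Hence
positive definiteness forces `Π Γ > 0`, and the case of vanishing orthogonal parts gives `Π > 0`.
Conversely the convexity condition persists when the orthogonal parts are scaled down to `0`, along
which both eigenvalues on the plane start at `Π > 0` and have a product that stays positive, so both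
are positive (`pos_of_det_pos_of_scaling`, `transversal_pos_of_convexityCondition`).

For necessity all admissible numbers have to be realised on `M`. Linear algebra realises them on a
tangent space with any inner product (`exists_realisation`), `M` carries a Riemannian metric
(`nonempty_metric`), and a covector of norm less than `b₀` extends to a one-form of norm less than
`b₀` everywhere (`exists_oneForm`).
-/

namespace ABC

/-! ### Calculus of functions of two variables -/

section Calculus

variable {U : Set (ℝ × ℝ)} {Ψ : ℝ → ℝ → ℝ} {s s' : ℝ}

theorem hasFDerivAt_uncurry (hU : IsOpen U) (hΨ : ContDiffOn ℝ ∞ (Function.uncurry Ψ) U)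
    (h : (s, s') ∈ U) :
    HasFDerivAt (Function.uncurry Ψ) (fderiv ℝ (Function.uncurry Ψ) (s, s')) (s, s') :=
  ((hΨ.contDiffAt (hU.mem_nhds h)).differentiableAt (by simp)).hasFDerivAt

theorem dS_eq_fderiv (hU : IsOpen U) (hΨ : ContDiffOn ℝ ∞ (Function.uncurry Ψ) U)
    (h : (s, s') ∈ U) : dS Ψ s s' = fderiv ℝ (Function.uncurry Ψ) (s, s') (1, 0) :=
  ((hasFDerivAt_uncurry hU hΨ h).comp_hasDerivAt (f := fun u => (u, s')) s
    ((hasDerivAt_id s).prodMk (hasDerivAt_const s s'))).deriv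

theorem dS'_eq_fderiv (hU : IsOpen U) (hΨ : ContDiffOn ℝ ∞ (Function.uncurry Ψ) U)
    (h : (s, s') ∈ U) : dS' Ψ s s' = fderiv ℝ (Function.uncurry Ψ) (s, s') (0, 1) :=
  ((hasFDerivAt_uncurry hU hΨ h).comp_hasDerivAt (f := fun u => (s, u)) s'
    ((hasDerivAt_const s' s).prodMk (hasDerivAt_id s'))).deriv

theorem contDiffOn_dS (hU : IsOpen U) (hΨ : ContDiffOn ℝ ∞ (Function.uncurry Ψ) U) :
    ContDiffOn ℝ ∞ (Function.uncurry (dS Ψ)) U :=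
  ((hΨ.fderiv_of_isOpen hU (m := ∞) (by simp)).clm_apply contDiffOn_const).congr
    fun _ hp => dS_eq_fderiv hU hΨ hp

theorem contDiffOn_dS' (hU : IsOpen U) (hΨ : ContDiffOn ℝ ∞ (Function.uncurry Ψ) U) :
    ContDiffOn ℝ ∞ (Function.uncurry (dS' Ψ)) U :=
  ((hΨ.fderiv_of_isOpen hU (m := ∞) (by simp)).clm_apply contDiffOn_const).congr
    fun _ hp => dS'_eq_fderiv hU hΨ hp

theorem dS_dS' (hU : IsOpen U) (hΨ : ContDiffOn ℝ ∞ (Function.uncurry Ψ) U)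
    (h : (s, s') ∈ U) : dS (dS' Ψ) s s' = dS' (dS Ψ) s s' := by
  have hfd : DifferentiableAt ℝ (fderiv ℝ (Function.uncurry Ψ)) (s, s') :=
    ((hΨ.fderiv_of_isOpen hU (m := ∞) (by simp)).contDiffAt (hU.mem_nhds h)).differentiableAt
      (by simp)
  have hS : Function.uncurry (dS Ψ) =ᶠ[𝓝 (s, s')]
      fun p => fderiv ℝ (Function.uncurry Ψ) p (1, 0) := by
    filter_upwards [hU.mem_nhds h] with p hp using dS_eq_fderiv hU hΨ hp
  have hS' : Function.uncurry (dS' Ψ) =ᶠ[𝓝 (s, s')]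
      fun p => fderiv ℝ (Function.uncurry Ψ) p (0, 1) := by
    filter_upwards [hU.mem_nhds h] with p hp using dS'_eq_fderiv hU hΨ hp
  rw [dS_eq_fderiv hU (contDiffOn_dS' hU hΨ) h, dS'_eq_fderiv hU (contDiffOn_dS hU hΨ) h,
    hS.fderiv_eq, hS'.fderiv_eq, fderiv_clm_apply hfd (by fun_prop),
    fderiv_clm_apply hfd (by fun_prop)]
  have := ((hΨ.contDiffAt (hU.mem_nhds h)).isSymmSndFDerivAt (n := ∞)
    (by simpa using WithTop.coe_le_coe.2 (le_top : (2 : ℕ∞) ≤ ⊤))).eq (1, 0) (0, 1)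
  simpa using this

/-- The chain rule for `Ψ` along a plane curve, in terms of the two partial derivatives. -/
theorem hasDerivAt_comp_curve (hU : IsOpen U) (hΨ : ContDiffOn ℝ ∞ (Function.uncurry Ψ) U)
    {f g : ℝ → ℝ} {f' g' t : ℝ} (hf : HasDerivAt f f' t) (hg : HasDerivAt g g' t)
    (h : (f t, g t) ∈ U) :
    HasDerivAt (fun t => Ψ (f t) (g t)) (f' * dS Ψ (f t) (g t) + g' * dS' Ψ (f t) (g t)) t := by
  have := (hasFDerivAt_uncurry hU hΨ h).comp_hasDerivAt t (hf.prodMk hg)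
  have e : ((f', g') : ℝ × ℝ) = f' • (1, 0) + g' • (0, 1) := by simp
  rw [e, map_add, map_smul, map_smul, ← dS_eq_fderiv hU hΨ h, ← dS'_eq_fderiv hU hΨ h] at this
  exact this

end Calculus

/-- The value at `(p, q)` of the Hessian form of `Ψ` at `(s, s')`. -/
noncomputable def hess (Ψ : ℝ → ℝ → ℝ) (s s' p q : ℝ) : ℝ :=
  dS (dS Ψ) s s' * p ^ 2 + 2 * dS' (dS Ψ) s s' * (p * q) + dS' (dS' Ψ) s s' * q ^ 2

/-- Along a line `y + t u`, on which `α² = Y + 2 e t + N t²`, `β = b + b' t` and `γ = c + c' t`,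
the function `F = α Ψ(β/α, γ/α)` satisfies `F' = α' Π + β' Ψ_s + γ' Ψ_{s̄}`; a second
differentiation gives `α F'' = (N - e²/Y) Π + Hess Ψ (β' - s α', γ' - s̄ α')`. -/
theorem half_deriv_deriv_sq {U : Set (ℝ × ℝ)} {Ψ : ℝ → ℝ → ℝ} (hU : IsOpen U)
    (hΨ : ContDiffOn ℝ ∞ (Function.uncurry Ψ) U) {Y e N b b' c c' r s s' : ℝ} (hY : 0 < Y)
    (hr : r = √Y) (hs : s = b / r) (hs' : s' = c / r) (h : (s, s') ∈ U) :
    (1 / 2) * deriv (deriv fun t : ℝ => (√(Y + 2 * e * t + N * t ^ 2) *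
      Ψ ((b + b' * t) / √(Y + 2 * e * t + N * t ^ 2))
        ((c + c' * t) / √(Y + 2 * e * t + N * t ^ 2))) ^ 2) 0 =
      (e / r * bigPi Ψ s s' + b' * dS Ψ s s' + c' * dS' Ψ s s') ^ 2 +
      Ψ s s' * ((N - e ^ 2 / Y) * bigPi Ψ s s' +
        hess Ψ s s' (b' - s * (e / r)) (c' - s' * (e / r))) := by
  set a : ℝ → ℝ := fun t => √(Y + 2 * e * t + N * t ^ 2) with ha
  set σ : ℝ → ℝ := fun t => (b + b' * t) / a t with hσ
  set τ : ℝ → ℝ := fun t => (c + c' * t) / a t with hτ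
  have a0 : a 0 = r := by simp [ha, hr]
  have hr0 : 0 < r := hr ▸ Real.sqrt_pos.2 hY
  have hrY : r ^ 2 = Y := by rw [hr, Real.sq_sqrt hY.le]
  have σ0 : σ 0 = s := by simp [hσ, a0, hs]
  have τ0 : τ 0 = s' := by simp [hτ, a0, hs']
  have hac : Continuous a := by fun_prop
  have hpos : ∀ᶠ t in 𝓝 (0 : ℝ), 0 < a t :=
    hac.continuousAt.eventually (lt_mem_nhds (by rw [a0]; exact hr0))
  have hσc : ContinuousAt σ 0 :=
    ContinuousAt.div (by fun_prop) hac.continuousAt (by rw [a0]; exact hr0.ne')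
  have hτc : ContinuousAt τ 0 :=
    ContinuousAt.div (by fun_prop) hac.continuousAt (by rw [a0]; exact hr0.ne')
  have hmem : ∀ᶠ t in 𝓝 (0 : ℝ), (σ t, τ t) ∈ U :=
    (hσc.prodMk hτc).eventually (hU.mem_nhds (by simpa only [σ0, τ0] using h))
  have da : ∀ t, 0 < a t → HasDerivAt a ((e + N * t) / a t) t := by
    intro t ht
    have h1 : HasDerivAt (fun t : ℝ => Y + 2 * e * t + N * t ^ 2) (2 * e + N * (2 * t)) t := by
      have := (((hasDerivAt_id t).const_mul (2 * e)).const_add Y).add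
        (((hasDerivAt_id t).pow 2).const_mul N)
      exact this.congr_deriv (by simp)
    have := h1.sqrt (Real.sqrt_pos.1 ht).ne'
    refine this.congr_deriv ?_
    change _ / (2 * a t) = _ / a t
    field_simp
  have dlin : ∀ m m' t : ℝ, HasDerivAt (fun t => m + m' * t) m' t := by
    intro m m' t
    simpa using ((hasDerivAt_id t).const_mul m').const_add m
  have dσ : ∀ t, 0 < a t → HasDerivAt σ ((b' - σ t * ((e + N * t) / a t)) / a t) t := by
    intro t ht
    refine ((dlin b b' t).div (da t ht) ht.ne').congr_deriv ?_
    simp only [hσ]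
    field_simp
  have dτ : ∀ t, 0 < a t → HasDerivAt τ ((c' - τ t * ((e + N * t) / a t)) / a t) t := by
    intro t ht
    refine ((dlin c c' t).div (da t ht) ht.ne').congr_deriv ?_
    simp only [hτ]
    field_simp
  -- the derivative of `F` along the line
  set G : ℝ → ℝ := fun t => (e + N * t) / a t * bigPi Ψ (σ t) (τ t) + b' * dS Ψ (σ t) (τ t) +
    c' * dS' Ψ (σ t) (τ t) with hG
  have dF : ∀ t, 0 < a t → (σ t, τ t) ∈ U →
      HasDerivAt (fun t => a t * Ψ (σ t) (τ t)) (G t) t := by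
    intro t ht hm
    refine ((da t ht).mul (hasDerivAt_comp_curve hU hΨ (dσ t ht) (dτ t ht) hm)).congr_deriv ?_
    simp only [hG, bigPi]
    field_simp
    ring
  have dG : HasDerivAt G (1 / r * ((N - e ^ 2 / Y) * bigPi Ψ s s' +
        hess Ψ s s' (b' - s * (e / r)) (c' - s' * (e / r)))) 0 := by
    have p0 : 0 < a 0 := a0 ▸ hr0
    have m0 : (σ 0, τ 0) ∈ U := by simpa only [σ0, τ0] using h
    have d1 := hasDerivAt_comp_curve hU hΨ (dσ 0 p0) (dτ 0 p0) m0
    have d2 := hasDerivAt_comp_curve hU (contDiffOn_dS hU hΨ) (dσ 0 p0) (dτ 0 p0) m0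
    have d3 := hasDerivAt_comp_curve hU (contDiffOn_dS' hU hΨ) (dσ 0 p0) (dτ 0 p0) m0
    have := ((((dlin e N 0).div (da 0 p0) p0.ne').mul
      ((d1.sub ((dσ 0 p0).mul d2)).sub ((dτ 0 p0).mul d3))).add (d2.const_mul b')).add
      (d3.const_mul c')
    refine this.congr_deriv ?_
    simp only [Pi.sub_apply, Pi.mul_apply, Pi.div_apply, a0, σ0, τ0, bigPi, hess, ← hrY,
      dS_dS' hU hΨ h]
    field_simp
    ring
  have d1 : deriv (fun t => (a t * Ψ (σ t) (τ t)) ^ 2) =ᶠ[𝓝 0]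
      fun t => 2 * (a t * Ψ (σ t) (τ t)) * G t := by
    filter_upwards [hpos, hmem] with t ht hm
    simpa using ((dF t ht hm).fun_pow 2).deriv
  have p0 : 0 < a 0 := a0 ▸ hr0
  have m0 : (σ 0, τ 0) ∈ U := by simpa only [σ0, τ0] using h
  rw [show deriv (deriv fun t : ℝ => (a t * Ψ (σ t) (τ t)) ^ 2) 0 = _ from d1.deriv_eq,
    (((dF 0 p0 m0).const_mul 2).fun_mul dG).deriv]
  simp only [hG, a0, σ0, τ0]
  field_simp
  ring

/-! ### The convexity condition in terms of Gram matrices -/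

/-- `Γ` as a function of the entries `P = b² - s²`, `S = g² - s̄²`, `R = θ - s s̄` of the Gram
matrix of the parts of the two covectors that are orthogonal to the vector. -/
noncomputable def gramGamma (Ψ : ℝ → ℝ → ℝ) (s s' P S R : ℝ) : ℝ :=
  bigPi Ψ s s' + P * dS (dS Ψ) s s' + S * dS' (dS' Ψ) s s' + 2 * R * dS' (dS Ψ) s s' +
    (P * S - R ^ 2) * bigJ Ψ s s'

theorem admissible_of_gram {n : ℕ} {b₀ g₀ s s' P S R : ℝ} (hP : 0 ≤ P) (hS : 0 ≤ S)
    (hR : 0 ≤ R) (hb₀ : 0 < b₀) (hg₀ : 0 < g₀) (hb : s ^ 2 + P < b₀ ^ 2)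
    (hg : s' ^ 2 + S < g₀ ^ 2) (hcs : R ^ 2 ≤ P * S) (h2 : n = 2 → R ^ 2 = P * S) :
    Admissible n b₀ g₀ s s' √(s ^ 2 + P) √(s' ^ 2 + S) (s * s' + R) where
  abs_s_le := Real.abs_le_sqrt (by linarith)
  b_lt := (Real.sqrt_lt' hb₀).2 hb
  abs_s'_le := Real.abs_le_sqrt (by linarith)
  g_lt := (Real.sqrt_lt' hg₀).2 hg
  nonneg := by linarith
  cauchy_schwarz := by
    rw [Real.sq_sqrt (by positivity), Real.sq_sqrt (by positivity)]
    linarith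
  eq_of_dim_two h := by
    rw [Real.sq_sqrt (by positivity), Real.sq_sqrt (by positivity)]
    linarith [h2 h]

theorem bigGamma_sqrt (Ψ : ℝ → ℝ → ℝ) {s s' P S R : ℝ} (hP : 0 ≤ P) (hS : 0 ≤ S) :
    bigGamma Ψ s s' √(s ^ 2 + P) √(s' ^ 2 + S) (s * s' + R) = gramGamma Ψ s s' P S R := by
  unfold bigGamma gramGamma
  rw [Real.sq_sqrt (by positivity), Real.sq_sqrt (by positivity)]
  ring

/-- A symmetric form `Π I + Mᵀ H M` of two variables, for `M` with rows `(p₁, p₂)`, `(q₁, q₂)`, is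
positive definite if its determinant remains positive when `M` is scaled down to `0`: its two
eigenvalues start at `Π > 0` and cannot change sign. -/
theorem pos_of_det_pos_of_scaling {k h₁ h₂ h₃ p₁ p₂ q₁ q₂ : ℝ} (hk : 0 < k)
    (h : ∀ t : ℝ, 0 ≤ t → t ≤ 1 →
      0 < k + t * (p₁ ^ 2 + p₂ ^ 2) * h₁ + t * (q₁ ^ 2 + q₂ ^ 2) * h₃ +
        2 * (t * (p₁ * q₁ + p₂ * q₂)) * h₂ +
        (t * (p₁ ^ 2 + p₂ ^ 2) * (t * (q₁ ^ 2 + q₂ ^ 2)) - (t * (p₁ * q₁ + p₂ * q₂)) ^ 2) *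
          ((h₁ * h₃ - h₂ * h₂) / k))
    {u₁ u₂ N : ℝ} (hN : 0 < N) (hu : u₁ ^ 2 + u₂ ^ 2 ≤ N) :
    0 < N * k + (h₁ * (p₁ * u₁ + p₂ * u₂) ^ 2 +
      2 * h₂ * ((p₁ * u₁ + p₂ * u₂) * (q₁ * u₁ + q₂ * u₂)) + h₃ * (q₁ * u₁ + q₂ * u₂) ^ 2) := by
  -- entries of `Mᵀ H M`
  set A := h₁ * p₁ ^ 2 + 2 * h₂ * (p₁ * q₁) + h₃ * q₁ ^ 2 with hA
  set C := h₁ * (p₁ * p₂) + h₂ * (p₁ * q₂ + p₂ * q₁) + h₃ * (q₁ * q₂) with hC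
  set D := h₁ * p₂ ^ 2 + 2 * h₂ * (p₂ * q₂) + h₃ * q₂ ^ 2 with hD
  have key : ∀ t : ℝ, 0 ≤ t → t ≤ 1 → 0 < k ^ 2 + t * k * (A + D) + t ^ 2 * (A * D - C ^ 2) := by
    intro t h0 h1
    refine (mul_pos hk (h t h0 h1)).trans_eq ?_
    field_simp
    rw [hA, hC, hD]
    ring
  have hdet : 0 < (k + A) * (k + D) - C ^ 2 := by
    have := key 1 zero_le_one le_rfl
    linarith
  have htr : 0 < 2 * k + (A + D) := by
    by_contra hneg
    have hT : A + D < 0 := by linarith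
    -- at the scale at which the trace vanishes, the determinant cannot be positive
    have ht := key (-(2 * k) / (A + D)) (div_nonneg_of_nonpos (by linarith) hT.le)
      ((div_le_one_of_neg hT).2 (by linarith))
    have : k ^ 2 + -(2 * k) / (A + D) * k * (A + D) + (-(2 * k) / (A + D)) ^ 2 * (A * D - C ^ 2) =
        -(k ^ 2 * ((A - D) ^ 2 + 4 * C ^ 2) / (A + D) ^ 2) := by
      field_simp [hT.ne]
      ring
    rw [this] at ht
    have : 0 ≤ k ^ 2 * ((A - D) ^ 2 + 4 * C ^ 2) / (A + D) ^ 2 := by positivity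
    linarith
  have hA' : 0 < k + A := by
    by_contra hneg
    nlinarith [sq_nonneg C, mul_nonneg (show (0 : ℝ) ≤ -(k + A) by linarith)
      (show (0 : ℝ) ≤ k + D by linarith)]
  have hform : N * k + (h₁ * (p₁ * u₁ + p₂ * u₂) ^ 2 +
      2 * h₂ * ((p₁ * u₁ + p₂ * u₂) * (q₁ * u₁ + q₂ * u₂)) + h₃ * (q₁ * u₁ + q₂ * u₂) ^ 2) =
      (N - (u₁ ^ 2 + u₂ ^ 2)) * k +
        (((k + A) * u₁ + C * u₂) ^ 2 + ((k + A) * (k + D) - C ^ 2) * u₂ ^ 2) / (k + A) := by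
    field_simp
    rw [hA, hC, hD]
    ring
  rw [hform]
  have h1 : 0 ≤ (N - (u₁ ^ 2 + u₂ ^ 2)) * k := mul_nonneg (by linarith) hk.le
  have h2 : 0 ≤ (((k + A) * u₁ + C * u₂) ^ 2 + ((k + A) * (k + D) - C ^ 2) * u₂ ^ 2) / (k + A) := by
    positivity
  refine lt_of_le_of_ne (add_nonneg h1 h2) fun h0 => ?_
  have h2' : (((k + A) * u₁ + C * u₂) ^ 2 + ((k + A) * (k + D) - C ^ 2) * u₂ ^ 2) / (k + A) = 0 := by
    linarith
  have h3 : ((k + A) * u₁ + C * u₂) ^ 2 + ((k + A) * (k + D) - C ^ 2) * u₂ ^ 2 = 0 := by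
    rcases div_eq_zero_iff.1 h2' with h | h
    · exact h
    · exact absurd h hA'.ne'
  have hu2 : u₂ = 0 := by
    by_contra hne
    have : 0 < ((k + A) * (k + D) - C ^ 2) * u₂ ^ 2 := by positivity
    nlinarith [sq_nonneg ((k + A) * u₁ + C * u₂)]
  have hu1 : u₁ = 0 := by
    rw [hu2] at h3
    have : (k + A) * u₁ = 0 := by
      have : ((k + A) * u₁) ^ 2 = 0 := by linarith
      exact pow_eq_zero_iff two_ne_zero |>.1 this
    exact (mul_eq_zero.1 this).resolve_left hA'.ne'
  rw [hu1, hu2] at h0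
  have : 0 < N * k := mul_pos hN hk
  simp at h0
  rcases h0 with h | h <;> linarith

/-! ### Positive definite forms on a vector space -/

section Fibre

variable {V : Type*} [AddCommGroup V] [Module ℝ V] {B : V →ₗ[ℝ] V →ₗ[ℝ] ℝ}

/-- A nonzero subspace contains a unit vector of which a given vector of the subspace is a
multiple. -/
theorem exists_unit_proportional (hpos : ∀ v, v ≠ 0 → 0 < B v v) {K : Submodule ℝ V}
    (hK : K ≠ ⊥) {q : V} (hq : q ∈ K) :
    ∃ e ∈ K, B e e = 1 ∧ ∃ c : ℝ, q = c • e := by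
  have unit : ∀ v : V, v ≠ 0 → B ((√(B v v))⁻¹ • v) ((√(B v v))⁻¹ • v) = 1 := by
    intro v hv
    have h := Real.sqrt_pos.2 (hpos v hv)
    simp only [map_smul, LinearMap.smul_apply, smul_eq_mul]
    nth_rw 3 [← Real.sq_sqrt (hpos v hv).le]
    field_simp
  by_cases h : q = 0
  · obtain ⟨v, hvK, hv⟩ := Submodule.exists_mem_ne_zero_of_ne_bot hK
    exact ⟨_, K.smul_mem _ hvK, unit v hv, 0, by simp [h]⟩
  · have h' := Real.sqrt_pos.2 (hpos q h)
    exact ⟨_, K.smul_mem _ hq, unit q h, √(B q q), by rw [smul_smul, mul_inv_cancel₀ h'.ne', one_smul]⟩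

theorem ker_ne_bot_of_one_lt_finrank (h : 1 < Module.finrank ℝ V) (f : V →ₗ[ℝ] ℝ) :
    LinearMap.ker f ≠ ⊥ := by
  have : FiniteDimensional ℝ V := FiniteDimensional.of_finrank_pos (by omega)
  exact LinearMap.ker_ne_bot_of_finrank_lt (by simpa using h)

theorem ker_inf_ker_ne_bot_of_two_lt_finrank (h : 2 < Module.finrank ℝ V) (f g : V →ₗ[ℝ] ℝ) :
    LinearMap.ker f ⊓ LinearMap.ker g ≠ ⊥ := by
  have : FiniteDimensional ℝ V := FiniteDimensional.of_finrank_pos (by omega)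
  rw [← LinearMap.ker_prod]
  exact LinearMap.ker_ne_bot_of_finrank_lt (by simpa using h)

/-- Bessel's inequality for an orthonormal pair. -/
theorem sq_add_sq_le_of_orthonormal (hsymm : ∀ v w, B v w = B w v)
    (hpos : ∀ v, v ≠ 0 → 0 < B v v) {e₁ e₂ : V} (h₁ : B e₁ e₁ = 1) (h₂ : B e₂ e₂ = 1)
    (h₁₂ : B e₁ e₂ = 0) (w : V) : B e₁ w ^ 2 + B e₂ w ^ 2 ≤ B w w := by
  have hnn : 0 ≤ B (w - B e₁ w • e₁ - B e₂ w • e₂) (w - B e₁ w • e₁ - B e₂ w • e₂) := by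
    by_cases h : w - B e₁ w • e₁ - B e₂ w • e₂ = 0
    · simp [h]
    · exact (hpos _ h).le
  simp only [map_sub, map_smul, LinearMap.sub_apply, LinearMap.smul_apply, smul_eq_mul, h₁, h₂,
    h₁₂, hsymm e₂ e₁, hsymm w e₁, hsymm w e₂] at hnn
  linarith

/-- In dimension two, the orthogonal complement of `y` is spanned by any of its unit vectors. -/
theorem eq_smul_of_finrank_eq_two (h2 : Module.finrank ℝ V = 2) (hsymm : ∀ v w, B v w = B w v)
    (hpos : ∀ v, v ≠ 0 → 0 < B v v) {y e w : V} (hy : y ≠ 0) (he : B e e = 1) (hye : B y e = 0)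
    (hw : B y w = 0) : w = B e w • e := by
  by_contra hne
  have hr : w - B e w • e ≠ 0 := sub_ne_zero.2 hne
  have hli : LinearIndependent ℝ ![y, e, w - B e w • e] := by
    refine LinearMap.linearIndependent_of_isOrthoᵢ (B := B) ?_ ?_
    · rw [LinearMap.isOrthoᵢ_def]
      intro i j hij
      fin_cases i <;> fin_cases j <;>
        simp_all [hsymm e y, hsymm w y, hsymm w e]
    · intro i
      fin_cases i
      · exact (hpos y hy).ne'
      · simp [he]
      · exact (hpos _ hr).ne'
  have : FiniteDimensional ℝ V := FiniteDimensional.of_finrank_pos (by omega)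
  have := hli.fintype_card_le_finrank
  simp [h2] at this

/-- The left side is positivity of `F_y(u)² + F F_{yy}(u, u)` for all `u ≠ 0`. The second summand
only depends on the part `w` of `u` orthogonal to `y`, and the first one vanishes for a suitable
choice of the part along `y`, so that positivity on the orthogonal complement of `y` of the form
`α F_{yy}`, the right side, is necessary and sufficient. -/
theorem pos_iff_transversal_pos (hsymm : ∀ v w, B v w = B w v) (hpos : ∀ v, v ≠ 0 → 0 < B v v)
    {Ψ : ℝ → ℝ → ℝ} {β γ : V →ₗ[ℝ] ℝ} {y : V} (hy : y ≠ 0) {r s s' : ℝ} (hr : r = √(B y y))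
    (hs : s = β y / r) (hs' : s' = γ y / r) (hΨ : 0 < Ψ s s') :
    (∀ u, u ≠ 0 → 0 < (B y u / r * bigPi Ψ s s' + β u * dS Ψ s s' + γ u * dS' Ψ s s') ^ 2 +
      Ψ s s' * ((B u u - B y u ^ 2 / B y y) * bigPi Ψ s s' +
        hess Ψ s s' (β u - s * (B y u / r)) (γ u - s' * (B y u / r)))) ↔
    ∀ w, B y w = 0 → w ≠ 0 → 0 < B w w * bigPi Ψ s s' + hess Ψ s s' (β w) (γ w) := by
  have hY := hpos y hy
  have hr0 : 0 < r := hr ▸ Real.sqrt_pos.2 hY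
  have hrY : B y y = r ^ 2 := by rw [hr, Real.sq_sqrt hY.le]
  have hβ : β y = s * r := by rw [hs]; field_simp
  have hγ : γ y = s' * r := by rw [hs']; field_simp
  constructor
  · intro h w hw hw0
    set c := -(β w * dS Ψ s s' + γ w * dS' Ψ s s') / (r * Ψ s s') with hc
    have hu : w + c • y ≠ 0 := by
      intro h0
      have := hpos w hw0
      have h1 : B w (w + c • y) = B w w := by simp [hsymm w y, hw]
      rw [h0, map_zero] at h1
      linarith
    have h1 := h _ hu
    have e1 : B y (w + c • y) = c * r ^ 2 := by simp [hw, hrY]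
    have e2 : B (w + c • y) (w + c • y) = B w w + c ^ 2 * r ^ 2 := by
      simp [hsymm w y, hw, hrY]; ring
    have e3 : β (w + c • y) = β w + c * (s * r) := by simp [hβ]
    have e4 : γ (w + c • y) = γ w + c * (s' * r) := by simp [hγ]
    rw [e1, e2, e3, e4, hrY] at h1
    have e5 : c * r ^ 2 / r * bigPi Ψ s s' + (β w + c * (s * r)) * dS Ψ s s' +
        (γ w + c * (s' * r)) * dS' Ψ s s' = 0 := by
      rw [hc]
      unfold bigPi
      field_simp
      ring
    rw [e5, show β w + c * (s * r) - s * (c * r ^ 2 / r) = β w by field_simp; ring,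
      show γ w + c * (s' * r) - s' * (c * r ^ 2 / r) = γ w by field_simp; ring,
      show B w w + c ^ 2 * r ^ 2 - (c * r ^ 2) ^ 2 / r ^ 2 = B w w by field_simp; ring] at h1
    have h2 : 0 < Ψ s s' * (B w w * bigPi Ψ s s' + hess Ψ s s' (β w) (γ w)) := by linarith
    exact pos_of_mul_pos_right h2 hΨ.le
  · intro h u hu
    set c := B y u / r ^ 2 with hc
    set w := u - c • y with hwdef
    have e1 : B y w = 0 := by simp [hwdef, hc, hrY]; field_simp; ring
    have e2 : B w w = B u u - B y u ^ 2 / B y y := by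
      simp [hwdef, hsymm u y, hrY, hc]; field_simp; ring
    have e3 : β w = β u - s * (B y u / r) := by simp [hwdef, hβ, hc]; field_simp
    have e4 : γ w = γ u - s' * (B y u / r) := by simp [hwdef, hγ, hc]; field_simp
    rw [← e2, ← e3, ← e4]
    by_cases hw : w = 0
    · have huc : u = c • y := by rw [← sub_eq_zero]; exact hw
      have hc0 : c ≠ 0 := by rintro h0; rw [h0, zero_smul] at huc; exact hu huc
      have e5 : B y u / r * bigPi Ψ s s' + β u * dS Ψ s s' + γ u * dS' Ψ s s' =
          c * (r * Ψ s s') := by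
        rw [huc]
        simp only [map_smul, smul_eq_mul, hβ, hγ, hrY, bigPi]
        field_simp
        ring
      rw [e5, hw]
      simp only [map_zero, hess]
      have : 0 < (c * (r * Ψ s s')) ^ 2 := by positivity
      simpa using this
    · have := mul_pos hΨ (h w e1 hw)
      positivity

end Fibre

/-! ### The transversal form and the numbers `Π`, `Γ` -/

section Fibre

variable {V : Type*} [AddCommGroup V] [Module ℝ V] {B : V →ₗ[ℝ] V →ₗ[ℝ] ℝ}

/-- Let `p` and `q` represent the two covectors. In dimension two, the form on the line orthogonal to
`y` is `Γ` times the metric. In higher dimension, the convexity condition also holds when the parts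
of `p` and `q` orthogonal to `y` are scaled down to `0`, since this preserves admissibility, and
`pos_of_det_pos_of_scaling` applies in coordinates on a plane that contains these parts. -/
theorem transversal_pos_of_convexityCondition {n : ℕ} (hn : 2 ≤ n)
    (hdim : Module.finrank ℝ V = n) (hsymm : ∀ v w, B v w = B w v)
    (hpos : ∀ v, v ≠ 0 → 0 < B v v) {Ψ : ℝ → ℝ → ℝ} {b₀ g₀ : ℝ} (hb₀ : 0 < b₀) (hg₀ : 0 < g₀)
    (hcond : ConvexityCondition n b₀ g₀ Ψ) {p q y : V} (hy : y ≠ 0) {r s s' : ℝ}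
    (hr : r = √(B y y)) (hs : s = B p y / r) (hs' : s' = B q y / r) (hp : B p p < b₀ ^ 2)
    (hq : B q q < g₀ ^ 2) (hpq : 0 ≤ B p q - s * s') {w : V} (hw : B y w = 0) (hw0 : w ≠ 0) :
    0 < B w w * bigPi Ψ s s' + hess Ψ s s' (B p w) (B q w) := by
  have hY := hpos y hy
  have hr0 : 0 < r := hr ▸ Real.sqrt_pos.2 hY
  have hrY : B y y = r ^ 2 := by rw [hr, Real.sq_sqrt hY.le]
  have hpy : B y p = s * r := by rw [hsymm, hs]; field_simp
  have hqy : B y q = s' * r := by rw [hsymm, hs']; field_simp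
  -- the parts of `p` and `q` orthogonal to `y`
  set p' := p - (s / r) • y with hp'
  set q' := q - (s' / r) • y with hq'
  have hp'y : B y p' = 0 := by simp [hp', hpy, hrY]; field_simp; ring
  have hq'y : B y q' = 0 := by simp [hq', hqy, hrY]; field_simp; ring
  have epp : B p p = s ^ 2 + B p' p' := by
    simp [hp', hsymm p y, hpy, hrY]; field_simp; ring
  have eqq : B q q = s' ^ 2 + B q' q' := by
    simp [hq', hsymm q y, hqy, hrY]; field_simp; ring
  have epq : B p q = s * s' + B p' q' := by
    simp [hp', hq', hsymm p y, hpy, hqy, hrY]; field_simp; ring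
  have epw : B p w = B p' w := by simp [hp', hw]
  have eqw : B q w = B q' w := by simp [hq', hw]
  obtain ⟨e, hey, he, c, hc⟩ := exists_unit_proportional hpos
    (ker_ne_bot_of_one_lt_finrank (by omega) (B y)) (q := p') (LinearMap.mem_ker.2 hp'y)
  rw [LinearMap.mem_ker] at hey
  have hwpos := hpos w hw0
  rcases hn.eq_or_lt with h2 | h3
  · have hq2 := eq_smul_of_finrank_eq_two (hdim.trans h2.symm) hsymm hpos hy he hey hq'y
    have hw2 := eq_smul_of_finrank_eq_two (hdim.trans h2.symm) hsymm hpos hy he hey hw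
    set d := B e q'
    set x := B e w
    have hx : x ≠ 0 := by rintro h; rw [h, zero_smul] at hw2; exact hw0 hw2
    have h1 : B p' p' = c ^ 2 := by simp [hc, he]; ring
    have h2' : B q' q' = d ^ 2 := by rw [hq2]; simp [he]; ring
    have h3 : B p' q' = c * d := by rw [hc, hq2]; simp [he]; ring
    have h4 : B p' w = c * x := by rw [hc, hw2]; simp [he]; ring
    have h5 : B q' w = d * x := by rw [hq2, hw2]; simp [he]; ring
    have h6 : B w w = x ^ 2 := by rw [hw2]; simp [he]; ring
    have := hcond.2 h2.symm _ _ _ _ _ (admissible_of_gram (s := s) (s' := s')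
      (sq_nonneg c) (sq_nonneg d)
      (by rw [← h3]; linarith : 0 ≤ c * d) hb₀ hg₀ (by linarith) (by linarith)
      (by rw [mul_pow]) (fun _ => by rw [mul_pow]))
    rw [bigGamma_sqrt Ψ (sq_nonneg c) (sq_nonneg d)] at this
    rw [epw, eqw, h4, h5, h6]
    refine (mul_pos (pow_pos (abs_pos.2 hx) 2) this).trans_eq ?_
    rw [sq_abs]
    unfold gramGamma hess
    ring
  · have hmem : q' - B e q' • e ∈ LinearMap.ker (B y) ⊓ LinearMap.ker (B e) := by
      simp [LinearMap.mem_ker, hq'y, hey, he]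
    obtain ⟨f, hf, hff, d, hd⟩ := exists_unit_proportional hpos
      (ker_inf_ker_ne_bot_of_two_lt_finrank (by omega) (B y) (B e)) hmem
    simp only [Submodule.mem_inf, LinearMap.mem_ker] at hf
    obtain ⟨hfy, hef⟩ := hf
    have hq2 : q' = B e q' • e + d • f := by rw [← hd]; abel
    set m := B e q'
    have h1 : B p' p' = c ^ 2 + 0 ^ 2 := by simp [hc, he]; ring
    have h2' : B q' q' = m ^ 2 + d ^ 2 := by rw [hq2]; simp [he, hff, hef, hsymm f e]; ring
    have h3' : B p' q' = c * m + 0 * d := by rw [hc, hq2]; simp [he, hef]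
    have h4 : B p' w = c * B e w + 0 * B f w := by rw [hc]; simp
    have h5 : B q' w = m * B e w + d * B f w := by rw [hq2]; simp
    have hR : 0 ≤ c * m + 0 * d := by rw [← h3']; linarith
    have adm : ∀ t : ℝ, 0 ≤ t → t ≤ 1 → Admissible n b₀ g₀ s s'
        √(s ^ 2 + t * (c ^ 2 + 0 ^ 2)) √(s' ^ 2 + t * (m ^ 2 + d ^ 2))
        (s * s' + t * (c * m + 0 * d)) := by
      intro t h0 h1'
      have i1 : t * (c ^ 2 + 0 ^ 2) ≤ c ^ 2 + 0 ^ 2 := mul_le_of_le_one_left (by positivity) h1'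
      have i2 : t * (m ^ 2 + d ^ 2) ≤ m ^ 2 + d ^ 2 := mul_le_of_le_one_left (by positivity) h1'
      refine admissible_of_gram (by positivity) (by positivity) (mul_nonneg h0 hR) hb₀ hg₀
        (by linarith) (by linarith) ?_ (fun h => by omega)
      have : 0 ≤ (t * c * d) ^ 2 := sq_nonneg _
      linarith
    have hk : 0 < bigPi Ψ s s' := (hcond.1 h3 _ _ _ _ _ (adm 0 le_rfl zero_le_one)).1
    rw [epw, eqw, h4, h5]
    refine pos_of_det_pos_of_scaling hk (fun t h0 h1' => ?_) hwpos
      (sq_add_sq_le_of_orthonormal hsymm hpos he hff hef w)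
    have := (hcond.1 h3 _ _ _ _ _ (adm t h0 h1')).2
    rwa [bigGamma_sqrt Ψ (by positivity) (by positivity)] at this

/-- Admissible numbers are realised by two covectors, here represented by `p` and `q`, and a unit
vector `y`. In dimension at least three, the form on the orthogonal complement of `y` restricts to
a plane with determinant `Π Γ`; if both covectors are proportional to `y`, this form is `Π` times
the metric. -/
theorem exists_realisation {n : ℕ} (hn : 2 ≤ n) (hdim : Module.finrank ℝ V = n)
    (hsymm : ∀ v w, B v w = B w v) (hpos : ∀ v, v ≠ 0 → 0 < B v v) (Ψ : ℝ → ℝ → ℝ)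
    {b₀ g₀ s s' b g θ : ℝ} (h : Admissible n b₀ g₀ s s' b g θ) :
    ∃ p q y : V, B y y = 1 ∧ B p y = s ∧ B q y = s' ∧ B p p = b ^ 2 ∧ B q q = g ^ 2 ∧
      B p q = θ ∧
      ((∀ w, B y w = 0 → w ≠ 0 → 0 < B w w * bigPi Ψ s s' + hess Ψ s s' (B p w) (B q w)) →
        (n = 2 → 0 < bigGamma Ψ s s' b g θ) ∧
        (b = |s| → g = |s'| → 0 < bigPi Ψ s s') ∧
        (3 ≤ n → 0 < bigPi Ψ s s' → 0 < bigGamma Ψ s s' b g θ)) := by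
  have hP : 0 ≤ b ^ 2 - s ^ 2 := by
    have := pow_le_pow_left₀ (abs_nonneg s) h.abs_s_le 2
    rw [sq_abs] at this; linarith
  have hS : 0 ≤ g ^ 2 - s' ^ 2 := by
    have := pow_le_pow_left₀ (abs_nonneg s') h.abs_s'_le 2
    rw [sq_abs] at this; linarith
  have hR := h.nonneg
  have hcs := h.cauchy_schwarz
  have h2 := h.eq_of_dim_two
  obtain ⟨P, eP⟩ : ∃ P, P = b ^ 2 - s ^ 2 := ⟨_, rfl⟩
  obtain ⟨S, eS⟩ : ∃ S, S = g ^ 2 - s' ^ 2 := ⟨_, rfl⟩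
  obtain ⟨R, eR⟩ : ∃ R, R = θ - s * s' := ⟨_, rfl⟩
  have hΓ : bigGamma Ψ s s' b g θ = gramGamma Ψ s s' P S R := by rw [eP, eS, eR]; rfl
  rw [← eP] at hP hcs h2
  rw [← eS] at hS hcs h2
  rw [← eR] at hR hcs h2
  rw [hΓ]
  have htop : (⊤ : Submodule ℝ V) ≠ ⊥ := by
    intro h0
    have : Module.finrank ℝ (⊤ : Submodule ℝ V) = 0 := by rw [h0, finrank_bot]
    rw [finrank_top] at this
    omega
  obtain ⟨y, -, hy, -⟩ := exists_unit_proportional hpos htop (Submodule.zero_mem _)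
  have hy0 : y ≠ 0 := by rintro rfl; simp at hy
  obtain ⟨e, hye, he, -⟩ := exists_unit_proportional hpos
    (ker_ne_bot_of_one_lt_finrank (by omega) (B y)) (Submodule.zero_mem _)
  rw [LinearMap.mem_ker] at hye
  have hey : B e y = 0 := by rw [hsymm, hye]
  have he0 : e ≠ 0 := by rintro rfl; simp at he
  -- if the orthogonal parts vanish, the form is `Π` times the metric
  have hPi : ∀ p q : V, B p e = 0 ∧ B q e = 0 →
      (∀ w, B y w = 0 → w ≠ 0 → 0 < B w w * bigPi Ψ s s' + hess Ψ s s' (B p w) (B q w)) →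
      0 < bigPi Ψ s s' := by
    intro p q hpq hw
    have := hw e hye he0
    simpa [he, hpq.1, hpq.2, hess] using this
  have hP0 : b = |s| → P = 0 := by intro hb; rw [eP, hb, sq_abs, sub_self]
  have hS0 : g = |s'| → S = 0 := by intro hg; rw [eS, hg, sq_abs, sub_self]
  rcases hn.eq_or_lt with hn2 | hn3
  · have hR2 := h2 hn2.symm
    have hRPS : √P * √S = R := by
      rw [← Real.sqrt_mul hP, ← hR2, Real.sqrt_sq hR]
    refine ⟨s • y + √P • e, s' • y + √S • e, y, hy, by simp [hy, hey], by simp [hy, hey], ?_, ?_,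
      ?_, fun hw => ⟨fun _ => ?_, fun hb hg => ?_, fun h3 => by omega⟩⟩
    · simp [hy, hey, hye, he, Real.mul_self_sqrt hP]; linarith
    · simp [hy, hey, hye, he, Real.mul_self_sqrt hS]; linarith
    · simp [hy, hey, hye, he]
      linarith
    · refine (hw e hye he0).trans_eq ?_
      simp [he, hye, hess, gramGamma, Real.sq_sqrt hP, Real.sq_sqrt hS, hRPS, hR2]
      ring
    · exact hPi _ _ (by simp [hye, hP0 hb, hS0 hg]) hw
  · obtain ⟨f, hf, hff, -⟩ := exists_unit_proportional hpos
      (ker_inf_ker_ne_bot_of_two_lt_finrank (by omega) (B y) (B e)) (Submodule.zero_mem _)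
    simp only [Submodule.mem_inf, LinearMap.mem_ker] at hf
    obtain ⟨hyf, hef⟩ := hf
    have hfy : B f y = 0 := by rw [hsymm, hyf]
    have hfe : B f e = 0 := by rw [hsymm, hef]
    -- coordinates of the orthogonal parts with Gram matrix `(P, R; R, S)`
    obtain ⟨p₁, q₁, q₂, k1, k2, k3, k4⟩ : ∃ p₁ q₁ q₂ : ℝ, p₁ ^ 2 = P ∧ q₁ ^ 2 + q₂ ^ 2 = S ∧
        p₁ * q₁ = R ∧ (P = 0 → S = 0 → p₁ = 0 ∧ q₁ = 0) := by
      rcases hP.eq_or_lt with h0 | h0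
      · have : R = 0 := by
          rw [← h0, zero_mul] at hcs
          exact pow_eq_zero_iff two_ne_zero |>.1 (le_antisymm hcs (sq_nonneg R))
        exact ⟨0, 0, √S, by simp [← h0], by simp [Real.sq_sqrt hS], by simp [this], by simp⟩
      · have hsP := Real.sqrt_pos.2 h0
        refine ⟨√P, R / √P, √(S - R ^ 2 / P), Real.sq_sqrt hP, ?_, by field_simp,
          fun h => absurd h h0.ne'⟩
        rw [Real.sq_sqrt, div_pow, Real.sq_sqrt hP]
        · ring
        · rw [sub_nonneg, div_le_iff₀ h0]; linarith
    refine ⟨s • y + p₁ • e, s' • y + q₁ • e + q₂ • f, y, hy, by simp [hy, hey],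
      by simp [hy, hey, hfy], ?_, ?_, ?_, fun hw => ⟨fun h => by omega, fun hb hg => ?_,
        fun _ hk => ?_⟩⟩
    · simp [hy, hey, hye, he]; linarith
    · simp [hy, hey, hye, he, hyf, hfy, hfe, hef, hff]; linarith
    · simp [hy, hey, hye, he, hyf, hef]; linarith
    · obtain ⟨h1, h2⟩ := k4 (hP0 hb) (hS0 hg)
      exact hPi _ _ (by simp [hye, hfe, h1, h2]) hw
    · set k := bigPi Ψ s s' with hkdef
      set A := k + hess Ψ s s' p₁ q₁ with hA
      set C := dS' (dS Ψ) s s' * (p₁ * q₂) + dS' (dS' Ψ) s s' * (q₁ * q₂) with hC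
      have hA0 : 0 < A := by
        refine (hw e hye he0).trans_eq ?_
        simp [he, hye, hfe, hA]
      -- the determinant of the restriction to the plane of `e` and `f`, times `A`
      have hne : A • f - C • e ≠ 0 := by
        intro h0
        have : B f (A • f - C • e) = A := by simp [hff, hfe]
        rw [h0, map_zero] at this
        linarith
      have hdet := hw (A • f - C • e) (by simp [hyf, hye]) hne
      have : 0 < A * (k * gramGamma Ψ s s' P S R) := by
        refine hdet.trans_eq ?_
        simp only [map_sub, map_add, map_smul, LinearMap.sub_apply, LinearMap.add_apply,
          LinearMap.smul_apply, smul_eq_mul, hyf, hye, he, hff, hef, hfe, gramGamma, bigJ,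
          ← hkdef, ← k1, ← k2, ← k3, hA, hC, hess]
        field_simp
        ring
      exact pos_of_mul_pos_right (pos_of_mul_pos_right this hA0.le) hk.le

end Fibre

section Manifold

variable {n : ℕ} {M : Type*} [TopologicalSpace M] [ChartedSpace (EuclideanSpace ℝ (Fin n)) M]

/-! ### The metric and its dual on a tangent space -/

theorem finrank_tangentSpace (x : M) : Module.finrank ℝ (TangentSpace (𝓡 n) x) = n :=
  finrank_euclideanSpace_fin (𝕜 := ℝ)

instance (x : M) : FiniteDimensional ℝ (TangentSpace (𝓡 n) x) :=
  inferInstanceAs (FiniteDimensional ℝ (EuclideanSpace ℝ (Fin n)))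

/-- The coordinate vectors as a basis of `T_xM`. -/
noncomputable def coordBasis (x : M) : Module.Basis (Fin n) ℝ (TangentSpace (𝓡 n) x) :=
  (EuclideanSpace.basisFun (Fin n) ℝ).toBasis

theorem coordBasis_apply (x : M) (i : Fin n) : coordBasis x i = coordVec x i := by
  have := EuclideanSpace.basisFun_apply (Fin n) ℝ i
  rw [← OrthonormalBasis.coe_toBasis] at this
  exact this

theorem sum_coordVec (x : M) (v : TangentSpace (𝓡 n) x) :
    ∑ i, (coordBasis x).repr v i • coordVec x i = v := by
  conv_rhs => rw [← (coordBasis x).sum_repr v]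
  simp only [coordBasis_apply]

variable [IsManifold (𝓡 n) ∞ M]

/-- The inner product on `T_xM` as a bilinear form. -/
noncomputable def metricForm (a : Metric n M) (x : M) :
    TangentSpace (𝓡 n) x →ₗ[ℝ] TangentSpace (𝓡 n) x →ₗ[ℝ] ℝ :=
  LinearMap.mk₂ ℝ (fun v w => a.inner x v w) (by simp) (by simp) (by simp) (by simp)

@[simp] theorem metricForm_apply (a : Metric n M) (x : M) (v w : TangentSpace (𝓡 n) x) :
    metricForm a x v w = a.inner x v w := rfl

theorem metricForm_symm (a : Metric n M) (x : M) (v w : TangentSpace (𝓡 n) x) :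
    metricForm a x v w = metricForm a x w v := a.symm x v w

theorem metricForm_pos (a : Metric n M) (x : M) (v : TangentSpace (𝓡 n) x) (hv : v ≠ 0) :
    0 < metricForm a x v v := a.pos x v hv

theorem exists_eq_metricForm (a : Metric n M) (β : OneForm n M) (x : M) :
    ∃ p : TangentSpace (𝓡 n) x, ∀ v, β x v = metricForm a x p v := by
  have hinj : Function.Injective (metricForm a x) := by
    rw [← LinearMap.ker_eq_bot, LinearMap.ker_eq_bot']
    intro v hv
    by_contra hne
    have := metricForm_pos a x v hne
    rw [hv] at this
    simp at this
  have hsurj := (LinearMap.injective_iff_surjective_of_finrank_eq_finrank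
    (Subspace.dual_finrank_eq (K := ℝ) (V := TangentSpace (𝓡 n) x)).symm).1 hinj
  obtain ⟨p, hp⟩ := hsurj (β x).toLinearMap
  exact ⟨p, fun v => by rw [hp]; rfl⟩

/-- `a^{ij} b_i γ_j` is the inner product of the vectors that represent the two one-forms. -/
theorem dualInner_eq (a : Metric n M) (β γ : OneForm n M) (x : M) {p q : TangentSpace (𝓡 n) x}
    (hp : ∀ v, β x v = metricForm a x p v) (hq : ∀ v, γ x v = metricForm a x q v) :
    dualInner a β γ x = metricForm a x p q := by
  set G := metricMatrix a x with hG
  have hmul : ∀ v : TangentSpace (𝓡 n) x,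
      G.mulVec ((coordBasis x).repr v) = fun i => metricForm a x v (coordVec x i) := by
    intro v
    funext i
    conv_rhs => rw [metricForm_symm, ← sum_coordVec x v]
    simp [hG, metricMatrix, Matrix.mulVec, dotProduct, mul_comm]
  have hunit : IsUnit G := by
    rw [← Matrix.mulVec_injective_iff_isUnit]
    intro v w hvw
    by_contra hne
    set z : TangentSpace (𝓡 n) x := (coordBasis x).equivFun.symm (v - w) with hz
    have hzr : ⇑((coordBasis x).repr z) = v - w := by
      rw [← (coordBasis x).equivFun_apply, hz, LinearEquiv.apply_symm_apply]
    have h0 : z ≠ 0 := by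
      intro h
      rw [h] at hzr
      exact hne (sub_eq_zero.1 (by rw [← hzr]; simp))
    have h1 := hmul z
    rw [hzr, Matrix.mulVec_sub, sub_eq_zero.2 hvw] at h1
    have h2 : metricForm a x z z = 0 := by
      conv_lhs => enter [2]; rw [← sum_coordVec x z]
      rw [map_sum]
      refine Finset.sum_eq_zero fun i _ => ?_
      rw [map_smul, ← congrFun h1 i]
      simp
    exact (metricForm_pos a x z h0).ne' h2
  have hinv : ∀ i, ∑ j, G⁻¹ i j * γ x (coordVec x j) = (coordBasis x).repr q i := by
    intro i
    have h1 : G⁻¹.mulVec (G.mulVec ((coordBasis x).repr q)) = (coordBasis x).repr q := by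
      rw [Matrix.mulVec_mulVec, Matrix.nonsing_inv_mul _ ((Matrix.isUnit_iff_isUnit_det _).1 hunit),
        Matrix.one_mulVec]
    rw [hmul] at h1
    have := congrFun h1 i
    simpa [Matrix.mulVec, dotProduct, hq] using this
  unfold dualInner
  calc ∑ i, ∑ j, G⁻¹ i j * β x (coordVec x i) * γ x (coordVec x j)
      = ∑ i, (coordBasis x).repr q i * β x (coordVec x i) := by
        refine Finset.sum_congr rfl fun i _ => ?_
        rw [← hinv i, Finset.sum_mul]
        exact Finset.sum_congr rfl fun j _ => by ring
    _ = β x q := by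
        conv_rhs => rw [← sum_coordVec x q]
        simp
    _ = metricForm a x p q := hp q

theorem dualNorm_lt_iff (a : Metric n M) (β : OneForm n M) (x : M) {p : TangentSpace (𝓡 n) x}
    (hp : ∀ v, β x v = metricForm a x p v) {b₀ : ℝ} (hb₀ : 0 < b₀) :
    dualNorm a β x < b₀ ↔ metricForm a x p p < b₀ ^ 2 := by
  rw [dualNorm, dualInner_eq a β β x hp hp, Real.sqrt_lt' hb₀]

theorem alpha_pos (a : Metric n M) {p : TangentBundle (𝓡 n) M} (hp : p.2 ≠ 0) : 0 < alpha a p :=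
  Real.sqrt_pos.2 (a.pos p.1 p.2 hp)

/-- The inequality of Cauchy and Schwarz keeps `β / α` in the domain of `Ψ`. On the zero section the
ratio is `0`. -/
theorem abs_ratio_lt {a : Metric n M} {β : OneForm n M} {b₀ : ℝ} (hb₀ : 0 < b₀)
    {p : TangentBundle (𝓡 n) M} (h : dualNorm a β p.1 < b₀) : |ratio a β p| < b₀ := by
  by_cases h0 : p.2 = 0
  · simpa [ratio, h0] using hb₀
  obtain ⟨q, hq⟩ := exists_eq_metricForm a β p.1
  rw [dualNorm_lt_iff a β p.1 hq hb₀] at h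
  have hα := alpha_pos a h0
  have hY : metricForm a p.1 p.2 p.2 = alpha a p ^ 2 :=
    (Real.sq_sqrt (a.pos p.1 p.2 h0).le).symm
  rw [ratio, hq, abs_div, abs_of_pos hα, div_lt_iff₀ hα]
  refine abs_lt_of_sq_lt_sq ?_ (by positivity)
  have hnn : 0 ≤ metricForm a p.1 (alpha a p ^ 2 • q - metricForm a p.1 q p.2 • p.2)
      (alpha a p ^ 2 • q - metricForm a p.1 q p.2 • p.2) := by
    by_cases h : alpha a p ^ 2 • q - metricForm a p.1 q p.2 • p.2 = 0
    · rw [h]; simp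
    · exact (metricForm_pos a p.1 _ h).le
  rw [map_sub, map_smul, map_smul] at hnn
  simp only [LinearMap.sub_apply, LinearMap.smul_apply, map_sub, map_smul, smul_eq_mul,
    metricForm_symm a p.1 p.2 q, hY] at hnn
  have h1 : 0 ≤ alpha a p ^ 2 * (alpha a p ^ 2 * metricForm a p.1 q q -
      metricForm a p.1 q p.2 ^ 2) := by linarith
  have h2 := nonneg_of_mul_nonneg_right h1 (by positivity)
  have h3 : alpha a p ^ 2 * metricForm a p.1 q q < alpha a p ^ 2 * b₀ ^ 2 :=
    mul_lt_mul_of_pos_left h (by positivity)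
  linarith

theorem ratio_mem {a : Metric n M} {β γ : OneForm n M} {b₀ g₀ : ℝ} (hb₀ : 0 < b₀) (hg₀ : 0 < g₀)
    {p : TangentBundle (𝓡 n) M} (hβ : dualNorm a β p.1 < b₀) (hγ : dualNorm a γ p.1 < g₀) :
    (ratio a β p, ratio a γ p) ∈ Ioo (-b₀) b₀ ×ˢ Ioo (-g₀) g₀ :=
  ⟨abs_lt.1 (abs_ratio_lt hb₀ hβ), abs_lt.1 (abs_ratio_lt hg₀ hγ)⟩

/-! ### Properties of `F = α Ψ(β/α, γ/α)` -/

theorem alpha_smul (a : Metric n M) (x : M) (y : TangentSpace (𝓡 n) x) {c : ℝ} (hc : 0 < c) :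
    alpha a ⟨x, c • y⟩ = c * alpha a ⟨x, y⟩ := by
  simp only [alpha, map_smul, smul_apply, smul_eq_mul]
  rw [← mul_assoc, Real.sqrt_mul (by positivity), Real.sqrt_mul_self hc.le]

theorem ratio_smul (a : Metric n M) (β : OneForm n M) (x : M) (y : TangentSpace (𝓡 n) x) {c : ℝ}
    (hc : 0 < c) : ratio a β ⟨x, c • y⟩ = ratio a β ⟨x, y⟩ := by
  simp only [ratio, alpha_smul a x y hc, map_smul, smul_eq_mul]
  exact mul_div_mul_left _ _ hc.ne'

theorem abcMetric_smul (Ψ : ℝ → ℝ → ℝ) (a : Metric n M) (β γ : OneForm n M) (x : M)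
    (y : TangentSpace (𝓡 n) x) {c : ℝ} (hc : 0 < c) :
    abcMetric Ψ a β γ ⟨x, c • y⟩ = c * abcMetric Ψ a β γ ⟨x, y⟩ := by
  simp only [abcMetric, alpha_smul a x y hc, ratio_smul a _ x y hc, mul_assoc]

theorem contMDiff_oneForm_apply (β : OneForm n M) :
    ContMDiff (𝓡 n).tangent 𝓘(ℝ, ℝ) ∞ (fun p : TangentBundle (𝓡 n) M => β p.1 p.2) := by
  have hπ : ContMDiff (𝓡 n).tangent (𝓡 n) ∞
      (TotalSpace.proj : TangentBundle (𝓡 n) M → M) := contMDiff_proj _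
  have h : ContMDiff (𝓡 n).tangent ((𝓡 n).prod 𝓘(ℝ, ℝ)) ∞ (fun p : TangentBundle (𝓡 n) M =>
      TotalSpace.mk' ℝ (E := Bundle.Trivial M ℝ) p.1 (β p.1 p.2)) :=
    ContMDiff.clm_bundle_apply (F₁ := EuclideanSpace ℝ (Fin n)) (β.contMDiff.comp hπ) contMDiff_id
  intro p
  exact (contMDiffAt_totalSpace.1 (h p)).2

theorem contMDiff_metric_apply (a : Metric n M) :
    ContMDiff (𝓡 n).tangent 𝓘(ℝ, ℝ) ∞
      (fun p : TangentBundle (𝓡 n) M => a.inner p.1 p.2 p.2) := by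
  have hπ : ContMDiff (𝓡 n).tangent (𝓡 n) ∞
      (TotalSpace.proj : TangentBundle (𝓡 n) M → M) := contMDiff_proj _
  have h : ContMDiff (𝓡 n).tangent ((𝓡 n).prod 𝓘(ℝ, ℝ)) ∞ (fun p : TangentBundle (𝓡 n) M =>
      TotalSpace.mk' ℝ (E := Bundle.Trivial M ℝ) p.1 (a.inner p.1 p.2 p.2)) :=
    ContMDiff.clm_bundle_apply₂ (F₁ := EuclideanSpace ℝ (Fin n)) (F₂ := EuclideanSpace ℝ (Fin n))
      (a.contMDiff.comp hπ) contMDiff_id contMDiff_id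
  intro p
  exact (contMDiffAt_totalSpace.1 (h p)).2

theorem contMDiffOn_abcMetric {Ψ : ℝ → ℝ → ℝ} {b₀ g₀ : ℝ} (hb₀ : 0 < b₀) (hg₀ : 0 < g₀)
    (hΨ : ContDiffOn ℝ ∞ (Function.uncurry Ψ) (Ioo (-b₀) b₀ ×ˢ Ioo (-g₀) g₀))
    {a : Metric n M} {β γ : OneForm n M} (hβ : ∀ x, dualNorm a β x < b₀)
    (hγ : ∀ x, dualNorm a γ x < g₀) :
    ContMDiffOn (𝓡 n).tangent 𝓘(ℝ, ℝ) ∞ (abcMetric Ψ a β γ) {p | p.2 ≠ 0} := by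
  intro p hp
  refine ContMDiffAt.contMDiffWithinAt ?_
  have hα : ContMDiffAt (𝓡 n).tangent 𝓘(ℝ, ℝ) ∞ (alpha a) p :=
    ((Real.contDiffAt_sqrt (a.pos p.1 p.2 hp).ne').contMDiffAt).comp p (contMDiff_metric_apply a p)
  have hratio : ∀ δ : OneForm n M,
      ContMDiffAt (𝓡 n).tangent 𝓘(ℝ, ℝ) ∞ (ratio a δ) p := fun δ =>
    (contMDiff_oneForm_apply δ p).div₀ hα (alpha_pos a hp).ne'
  have hU : IsOpen (Ioo (-b₀) b₀ ×ˢ Ioo (-g₀) g₀) := isOpen_Ioo.prod isOpen_Ioo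
  have hΨ' := (hΨ.contDiffAt (hU.mem_nhds (ratio_mem hb₀ hg₀ (hβ p.1) (hγ p.1)))).contMDiffAt
  exact hα.mul (hΨ'.comp p ((hratio β).prodMk_space (hratio γ)))

theorem fundamentalForm_abcMetric {Ψ : ℝ → ℝ → ℝ} {b₀ g₀ : ℝ} (hb₀ : 0 < b₀) (hg₀ : 0 < g₀)
    (hΨ : ContDiffOn ℝ ∞ (Function.uncurry Ψ) (Ioo (-b₀) b₀ ×ˢ Ioo (-g₀) g₀))
    {a : Metric n M} {β γ : OneForm n M} {x : M} (hβ : dualNorm a β x < b₀)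
    (hγ : dualNorm a γ x < g₀) {y : TangentSpace (𝓡 n) x} (hy : y ≠ 0)
    (u : TangentSpace (𝓡 n) x) {r s s' : ℝ} (hr : r = alpha a ⟨x, y⟩) (hs : s = ratio a β ⟨x, y⟩)
    (hs' : s' = ratio a γ ⟨x, y⟩) :
    fundamentalForm (abcMetric Ψ a β γ) x y u u =
      (metricForm a x y u / r * bigPi Ψ s s' + β x u * dS Ψ s s' + γ x u * dS' Ψ s s') ^ 2 +
      Ψ s s' * ((metricForm a x u u - metricForm a x y u ^ 2 / metricForm a x y y) * bigPi Ψ s s' +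
        hess Ψ s s' (β x u - s * (metricForm a x y u / r))
          (γ x u - s' * (metricForm a x y u / r))) := by
  rw [← half_deriv_deriv_sq (b := β x y) (c := γ x y) (isOpen_Ioo.prod isOpen_Ioo) hΨ
    (metricForm_pos a x y hy) hr (by rw [hs, hr]; rfl) (by rw [hs', hr]; rfl)
    (by rw [hs, hs']; exact ratio_mem (p := ⟨x, y⟩) hb₀ hg₀ hβ hγ)]
  unfold fundamentalForm
  congr 2
  funext σ
  have e0 : ∀ t : ℝ, y + σ • u + t • u = y + (σ + t) • u := fun t => by rw [add_smul, add_assoc]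
  have e1 : ∀ t : ℝ, alpha a ⟨x, y + t • u⟩ = √(metricForm a x y y +
      2 * metricForm a x y u * t + metricForm a x u u * t ^ 2) := by
    intro t
    rw [alpha]
    congr 1
    change metricForm a x (y + t • u) (y + t • u) = _
    rw [map_add, map_smul]
    simp only [LinearMap.add_apply, LinearMap.smul_apply, map_add, map_smul, smul_eq_mul,
      metricForm_symm a x u y]
    ring
  have e2 : ∀ (δ : OneForm n M) (t : ℝ), δ x (y + t • u) = δ x y + δ x u * t := by
    intro δ t
    rw [map_add, map_smul, smul_eq_mul, mul_comm]
  simp only [e0]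
  rw [deriv_comp_const_add (fun t => abcMetric Ψ a β γ ⟨x, y + t • u⟩ ^ 2), add_zero]
  simp only [abcMetric, ratio, e1, e2]

end Manifold

/-! ### Existence of Riemannian metrics and of one-forms with prescribed values -/

/-- A positive definite form on a finite-dimensional space has a bounded unit ball, because it has a
positive lower bound on the unit sphere. -/
theorem isVonNBounded_of_pos {E : Type*} [NormedAddCommGroup E] [NormedSpace ℝ E]
    [FiniteDimensional ℝ E] (φ : E →L[ℝ] E →L[ℝ] ℝ) (hpos : ∀ v, v ≠ 0 → 0 < φ v v) :
    Bornology.IsVonNBounded ℝ {v : E | φ v v < 1} := by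
  rw [NormedSpace.isVonNBounded_iff]
  obtain ⟨c, hc, hbound⟩ : ∃ c > 0, ∀ v ∈ Metric.sphere (0 : E) 1, c ≤ φ v v := by
    rcases (Metric.sphere (0 : E) 1).eq_empty_or_nonempty with h | h
    · exact ⟨1, one_pos, by simp [h]⟩
    · obtain ⟨v₀, hv₀, hmin⟩ := (isCompact_sphere (0 : E) 1).exists_isMinOn
        h (f := fun v => φ v v) (φ.continuous.clm_apply continuous_id).continuousOn
      exact ⟨φ v₀ v₀, hpos v₀ (ne_zero_of_mem_unit_sphere ⟨v₀, hv₀⟩), fun v hv => hmin hv⟩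
  refine (Metric.isBounded_closedBall (x := (0 : E)) (r := √(1 / c))).subset fun v hv => ?_
  rw [mem_closedBall_zero_iff]
  by_cases h0 : v = 0
  · simp [h0]
  have hn : 0 < ‖v‖ := norm_pos_iff.2 h0
  have h1 := hbound (‖v‖⁻¹ • v) (by simp [norm_smul, hn.ne'])
  simp only [map_smul, smul_apply, smul_eq_mul] at h1
  have h2 : c * ‖v‖ ^ 2 ≤ φ v v := by
    have := mul_le_mul_of_nonneg_right h1 (sq_nonneg ‖v‖)
    refine this.trans_eq ?_
    field_simp
  refine Real.le_sqrt_of_sq_le ?_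
  rw [le_div_iff₀ hc]
  have h3 : φ v v < 1 := hv
  linarith

/-- The local section of a smooth vector bundle that is constant in a given local trivialization. -/
theorem exists_local_section {EB H B F : Type*} [NormedAddCommGroup EB] [NormedSpace ℝ EB]
    [TopologicalSpace H] {I : ModelWithCorners ℝ EB H} [TopologicalSpace B] [ChartedSpace H B]
    [NormedAddCommGroup F] [NormedSpace ℝ F] (V : B → Type*) [∀ x, AddCommGroup (V x)]
    [∀ x, Module ℝ (V x)] [∀ x, TopologicalSpace (V x)] [TopologicalSpace (TotalSpace F V)]
    [FiberBundle F V] [VectorBundle ℝ F V] [ContMDiffVectorBundle ∞ F V I] (x₀ : B) (c : F) :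
    ∃ s : ∀ x, V x, ContMDiffOn I (I.prod 𝓘(ℝ, F)) ∞ (fun x => TotalSpace.mk' F x (s x))
        (trivializationAt F V x₀).baseSet ∧
      ∀ x ∈ (trivializationAt F V x₀).baseSet, (trivializationAt F V x₀ ⟨x, s x⟩).2 = c := by
  set e := trivializationAt F V x₀
  have h : ∀ x ∈ e.baseSet, (e ⟨x, e.symm x c⟩).2 = c := fun x hx => by
    rw [e.apply_mk_symm hx]
  refine ⟨fun x => e.symm x c, ?_, h⟩
  rw [e.contMDiffOn_section_baseSet_iff]
  exact (contMDiffOn_const (c := c)).congr h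

/-- A bilinear form on a fibre, in terms of its expression in a local trivialization. -/
theorem hom_trivializationAt_apply_apply {B F : Type*} [TopologicalSpace B]
    [NormedAddCommGroup F] [NormedSpace ℝ F] (V : B → Type*) [∀ x, AddCommGroup (V x)]
    [∀ x, Module ℝ (V x)] [∀ x, TopologicalSpace (V x)] [TopologicalSpace (TotalSpace F V)]
    [FiberBundle F V] [VectorBundle ℝ F V] {x₀ x : B}
    (hx : x ∈ (trivializationAt F V x₀).baseSet) (φ : V x →L[ℝ] V x →L[ℝ] ℝ) (v w : V x) :
    (trivializationAt (F →L[ℝ] F →L[ℝ] ℝ) (fun x => V x →L[ℝ] V x →L[ℝ] ℝ) x₀ ⟨x, φ⟩).2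
      ((trivializationAt F V x₀).continuousLinearEquivAt ℝ x hx v)
      ((trivializationAt F V x₀).continuousLinearEquivAt ℝ x hx w) = φ v w := by
  set A := (trivializationAt F V x₀).continuousLinearEquivAt ℝ x hx with hA
  have hsymm : ∀ v, (trivializationAt F V x₀).symm x (A v) = v := A.symm_apply_apply
  have h := inCoordinates_apply_eq₂ (𝕜 := ℝ) (F₃ := ℝ) (E₃ := Bundle.Trivial B ℝ) (ϕ := φ) (v := A v)
    (w := A w) hx hx (by simp)
  rw [hsymm, hsymm] at h
  refine h.trans ?_
  change (Bundle.Trivial.trivialization B ℝ).linearMapAt ℝ x (φ v w) = _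
  rw [Bundle.Trivial.linearMapAt_trivialization]
  rfl

theorem sigmaCompactSpace_of_chartedSpace (n : ℕ) (M : Type*) [TopologicalSpace M]
    [ChartedSpace (EuclideanSpace ℝ (Fin n)) M] [SecondCountableTopology M] :
    SigmaCompactSpace M := by
  have : LocallyCompactSpace M := Manifold.locallyCompact_of_finiteDimensional (𝓡 n)
  infer_instance

section Existence

variable {n : ℕ} {M : Type*} [TopologicalSpace M] [ChartedSpace (EuclideanSpace ℝ (Fin n)) M]
  [IsManifold (𝓡 n) ∞ M] [T2Space M] [SecondCountableTopology M]

set_option synthInstance.maxHeartbeats 100000 in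
/-- A manifold carries a Riemannian metric: the forms that are Euclidean in a local trivialization
are glued by a partition of unity. -/
theorem nonempty_metric : Nonempty (Metric n M) := by
  have : SigmaCompactSpace M := sigmaCompactSpace_of_chartedSpace n M
  have key := exists_contMDiffSection_forall_mem_convex_of_local (n := ⊤) (𝓡 n)
    (F_fiber := EuclideanSpace ℝ (Fin n) →L[ℝ] EuclideanSpace ℝ (Fin n) →L[ℝ] ℝ)
    (fun x : M => TangentSpace (𝓡 n) x →L[ℝ] TangentSpace (𝓡 n) x →L[ℝ] ℝ)
    (fun x => {φ | (∀ v w, φ v w = φ w v) ∧ ∀ v, v ≠ 0 → 0 < φ v v}) ?_ ?_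
  · obtain ⟨g, hg⟩ := key
    exact ⟨{
      inner := g
      symm := fun x => (hg x).1
      pos := fun x => (hg x).2
      isVonNBounded := fun x => isVonNBounded_of_pos (E := EuclideanSpace ℝ (Fin n)) (g x) (hg x).2
      contMDiff := g.contMDiff }⟩
  · intro x φ hφ ψ hψ s t hs ht hst
    refine ⟨fun v w => ?_, fun v hv => ?_⟩
    · simp [hφ.1 v w, hψ.1 v w]
    · have h1 := hφ.2 v hv
      have h2 := hψ.2 v hv
      simp only [add_apply, smul_apply, smul_eq_mul]
      rcases hs.eq_or_lt with h | h
      · have : t = 1 := by linarith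
        simp [← h, this, h2]
      · have := mul_pos h h1
        have := mul_nonneg ht h2.le
        linarith
  · intro x₀
    obtain ⟨s, hs, hsc⟩ := exists_local_section (I := 𝓡 n)
      (F := EuclideanSpace ℝ (Fin n) →L[ℝ] EuclideanSpace ℝ (Fin n) →L[ℝ] ℝ)
      (fun x : M => TangentSpace (𝓡 n) x →L[ℝ] TangentSpace (𝓡 n) x →L[ℝ] ℝ) x₀
      (innerSL ℝ (E := EuclideanSpace ℝ (Fin n)))
    refine ⟨_, (trivializationAt _ _ x₀).open_baseSet.mem_nhds
      (FiberBundle.mem_baseSet_trivializationAt' x₀), s, hs, fun x hx => ?_⟩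
    · have hbase : x ∈ (trivializationAt (EuclideanSpace ℝ (Fin n))
          (TangentSpace (𝓡 n) : M → Type _) x₀).baseSet := by
        simpa [hom_trivializationAt_baseSet] using hx
      set A := (trivializationAt (EuclideanSpace ℝ (Fin n))
        (TangentSpace (𝓡 n) : M → Type _) x₀).continuousLinearEquivAt ℝ x hbase with hA
      have hval : ∀ v w, s x v w = inner ℝ (A v) (A w) := by
        intro v w
        rw [← hom_trivializationAt_apply_apply (TangentSpace (𝓡 n) : M → Type _) hbase (s x) v w,
          hsc x hx]
        rfl
      refine ⟨fun v w => ?_, fun v hv => ?_⟩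
      · rw [hval, hval, real_inner_comm]
      · rw [hval]
        exact real_inner_self_pos.2 fun h => hv (A.map_eq_zero_iff.1 h)

/-- Every tangent vector is a value of a smooth vector field. -/
theorem exists_vectorField (x₀ : M) (v : TangentSpace (𝓡 n) x₀) :
    ∃ X : ContMDiffSection (𝓡 n) (EuclideanSpace ℝ (Fin n)) ∞
      (fun x : M => TangentSpace (𝓡 n) x), X x₀ = v := by
  classical
  have : SigmaCompactSpace M := sigmaCompactSpace_of_chartedSpace n M
  -- a convex condition on sections that is void away from `x₀`
  have key := exists_contMDiffSection_forall_mem_convex_of_local (n := ⊤) (𝓡 n)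
    (F_fiber := EuclideanSpace ℝ (Fin n)) (fun x : M => TangentSpace (𝓡 n) x)
    (fun x => {w | ∀ h : x = x₀, w = h ▸ v}) ?_ ?_
  · obtain ⟨X, hX⟩ := key
    exact ⟨X, hX x₀ rfl⟩
  · intro x φ hφ ψ hψ s t hs ht hst h
    rw [hφ h, hψ h, ← add_smul, hst, one_smul]
  · intro x₁
    by_cases hx : x₁ = x₀
    · subst hx
      obtain ⟨s, hs, hsc⟩ := exists_local_section (I := 𝓡 n) (F := EuclideanSpace ℝ (Fin n))
        (TangentSpace (𝓡 n) : M → Type _) x₁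
        (trivializationAt (EuclideanSpace ℝ (Fin n)) (TangentSpace (𝓡 n) : M → Type _) x₁ ⟨x₁, v⟩).2
      have hmem := FiberBundle.mem_baseSet_trivializationAt' (F := EuclideanSpace ℝ (Fin n))
        (E := (TangentSpace (𝓡 n) : M → Type _)) x₁
      refine ⟨_, (trivializationAt _ _ x₁).open_baseSet.mem_nhds hmem, s, hs, ?_⟩
      rintro x - rfl
      exact (Trivialization.linearEquivAt ℝ _ x hmem).injective (hsc x hmem)
    · refine ⟨{x₀}ᶜ, isOpen_compl_singleton.mem_nhds hx, fun x => 0, ?_, ?_⟩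
      · exact (contMDiff_zeroSection ℝ (TangentSpace (𝓡 n) : M → Type _)).contMDiffOn
      · intro x hx h
        exact absurd h hx

/-- Every covector of norm less than `b₀` is a value of a one-form of norm less than `b₀`. If `X`
is a vector field whose value represents the covector, the one-form is represented by
`2 c (c + h)⁻¹ X`, where `h = a(X, X)` and `c` is the value of `h` at the given point: by the
inequality of the means, its squared norm `4 c² h (c + h)⁻²` is at most `c`. -/
theorem exists_oneForm (a : Metric n M) (x₀ : M) (v : TangentSpace (𝓡 n) x₀) {b₀ : ℝ}
    (hb₀ : 0 < b₀) (hv : metricForm a x₀ v v < b₀ ^ 2) :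
    ∃ β : OneForm n M, (∀ w, β x₀ w = metricForm a x₀ v w) ∧ ∀ x, dualNorm a β x < b₀ := by
  by_cases hv0 : v = 0
  · refine ⟨0, fun w => by simp [hv0], fun x => ?_⟩
    rw [dualNorm_lt_iff a 0 x (p := 0) (by simp) hb₀]
    simpa using pow_pos hb₀ 2
  obtain ⟨X, hX⟩ := exists_vectorField x₀ v
  set c := metricForm a x₀ v v with hc
  have hcpos : 0 < c := metricForm_pos a x₀ v hv0
  set h : M → ℝ := fun x => metricForm a x (X x) (X x) with hh
  have hnn : ∀ x, 0 ≤ h x := by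
    intro x
    by_cases h0 : X x = 0
    · simp [hh, h0]
    · exact (metricForm_pos a x _ h0).le
  have hsmooth : ContMDiff (𝓡 n) 𝓘(ℝ, ℝ) ∞ h := (contMDiff_metric_apply a).comp X.contMDiff
  have hf : ContMDiff (𝓡 n) 𝓘(ℝ, ℝ) ∞ (fun x => 2 * c / (c + h x)) := by
    have h1 : ContMDiff (𝓡 n) 𝓘(ℝ, ℝ) ∞ (fun x => c + h x) := contMDiff_const.add hsmooth
    exact (contMDiff_const (c := 2 * c)).div₀ h1 fun x => by have := hnn x; positivity
  have hY : ContMDiff (𝓡 n) ((𝓡 n).prod 𝓘(ℝ, EuclideanSpace ℝ (Fin n))) ∞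
      (fun x : M => TotalSpace.mk' (EuclideanSpace ℝ (Fin n)) x
        ((2 * c / (c + h x)) • X x)) := hf.smul_section X.contMDiff
  let β : OneForm n M := ⟨fun x => a.inner x ((2 * c / (c + h x)) • X x),
    ContMDiff.clm_bundle_apply (F₁ := EuclideanSpace ℝ (Fin n)) a.contMDiff hY⟩
  have hβ : ∀ x w, β x w = metricForm a x ((2 * c / (c + h x)) • X x) w := fun _ _ => rfl
  refine ⟨β, fun w => ?_, fun x => ?_⟩
  · have : h x₀ = c := by rw [hh]; simp only [hX, hc]
    rw [hβ, this, hX, ← two_mul, div_self (by positivity), one_smul]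
  · rw [dualNorm_lt_iff a β x (hβ x) hb₀]
    refine lt_of_le_of_lt ?_ hv
    simp only [map_smul, LinearMap.smul_apply, smul_eq_mul]
    change 2 * c / (c + h x) * (2 * c / (c + h x) * h x) ≤ c
    have := hnn x
    have h1 : 2 * c / (c + h x) * (2 * c / (c + h x) * h x) =
        c - c * (c - h x) ^ 2 / (c + h x) ^ 2 := by
      field_simp
      ring
    rw [h1]
    have : 0 ≤ c * (c - h x) ^ 2 / (c + h x) ^ 2 := by positivity
    linarith

end Existence

/-! ### Strong convexity of `F` and the convexity condition -/

section Manifold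

variable {n : ℕ} {M : Type*} [TopologicalSpace M] [ChartedSpace (EuclideanSpace ℝ (Fin n)) M]
  [IsManifold (𝓡 n) ∞ M]

/-- The fundamental form of `F` at `y` is positive definite if and only if the form
`Π a(w, w) + Hess Ψ (β(w), γ(w))` is positive definite on the orthogonal complement of `y`. -/
theorem fundamentalForm_pos_iff {Ψ : ℝ → ℝ → ℝ} {b₀ g₀ : ℝ} (hb₀ : 0 < b₀) (hg₀ : 0 < g₀)
    (hΨ : ContDiffOn ℝ ∞ (Function.uncurry Ψ) (Ioo (-b₀) b₀ ×ˢ Ioo (-g₀) g₀))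
    (hΨpos : ∀ s ∈ Ioo (-b₀) b₀, ∀ s' ∈ Ioo (-g₀) g₀, 0 < Ψ s s')
    {a : Metric n M} {β γ : OneForm n M} {x : M} (hβ : dualNorm a β x < b₀)
    (hγ : dualNorm a γ x < g₀) {y : TangentSpace (𝓡 n) x} (hy : y ≠ 0) :
    (∀ u, u ≠ 0 → 0 < fundamentalForm (abcMetric Ψ a β γ) x y u u) ↔
      ∀ w, metricForm a x y w = 0 → w ≠ 0 → 0 < metricForm a x w w *
        bigPi Ψ (ratio a β ⟨x, y⟩) (ratio a γ ⟨x, y⟩) +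
        hess Ψ (ratio a β ⟨x, y⟩) (ratio a γ ⟨x, y⟩) (β x w) (γ x w) := by
  have hmem := ratio_mem (p := ⟨x, y⟩) hb₀ hg₀ hβ hγ
  simp only [fundamentalForm_abcMetric hb₀ hg₀ hΨ hβ hγ hy _ rfl rfl rfl]
  exact pos_iff_transversal_pos (β := (β x).toLinearMap) (γ := (γ x).toLinearMap)
    (metricForm_symm a x) (metricForm_pos a x) hy rfl rfl rfl (hΨpos _ hmem.1 _ hmem.2)

theorem isFinslerMetricOn_of_convexityCondition (hn : 2 ≤ n) {Ψ : ℝ → ℝ → ℝ} {b₀ g₀ : ℝ}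
    (hb₀ : 0 < b₀) (hg₀ : 0 < g₀)
    (hΨ : ContDiffOn ℝ ∞ (Function.uncurry Ψ) (Ioo (-b₀) b₀ ×ˢ Ioo (-g₀) g₀))
    (hΨpos : ∀ s ∈ Ioo (-b₀) b₀, ∀ s' ∈ Ioo (-g₀) g₀, 0 < Ψ s s')
    (hcond : ConvexityCondition n b₀ g₀ Ψ) {a : Metric n M} {β γ : OneForm n M}
    (hβ : ∀ x, dualNorm a β x < b₀) (hγ : ∀ x, dualNorm a γ x < g₀) :
    IsFinslerMetricOn (abcMetric Ψ a β γ) (thetaRegion a β γ) where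
  nonneg p := by
    have hmem := ratio_mem hb₀ hg₀ (hβ p.1) (hγ p.1)
    exact mul_nonneg (Real.sqrt_nonneg _) (hΨpos _ hmem.1 _ hmem.2).le
  smooth := contMDiffOn_abcMetric hb₀ hg₀ hΨ hβ hγ
  homogeneous x y c hc := abcMetric_smul Ψ a β γ x y hc
  posDef x y hy hA := by
    rw [fundamentalForm_pos_iff hb₀ hg₀ hΨ hΨpos (hβ x) (hγ x) hy]
    intro w hw hw0
    obtain ⟨p, hp⟩ := exists_eq_metricForm a β x
    obtain ⟨q, hq⟩ := exists_eq_metricForm a γ x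
    have hpq : 0 ≤ metricForm a x p q - ratio a β ⟨x, y⟩ * ratio a γ ⟨x, y⟩ := by
      rw [← dualInner_eq a β γ x hp hq]; exact hA
    rw [hp w, hq w]
    exact transversal_pos_of_convexityCondition hn (finrank_tangentSpace x) (metricForm_symm a x)
      (metricForm_pos a x) hb₀ hg₀ hcond hy rfl (by rw [← hp]; rfl) (by rw [← hq]; rfl)
      ((dualNorm_lt_iff a β x hp hb₀).1 (hβ x)) ((dualNorm_lt_iff a γ x hq hg₀).1 (hγ x)) hpq hw hw0

/-- Any admissible numbers occur at a given point of `M`, for a fixed metric and suitable one-forms.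
For `3 ≤ n` the determinant on a transversal plane gives `Π Γ > 0`, and the sign of `Π` is that of
the transversal form when both covectors are proportional to `y`. -/
theorem convexityCondition_of_isFinslerMetricOn [T2Space M] [SecondCountableTopology M]
    [Nonempty M] (hn : 2 ≤ n) {Ψ : ℝ → ℝ → ℝ} {b₀ g₀ : ℝ} (hb₀ : 0 < b₀) (hg₀ : 0 < g₀)
    (hΨ : ContDiffOn ℝ ∞ (Function.uncurry Ψ) (Ioo (-b₀) b₀ ×ˢ Ioo (-g₀) g₀))
    (hΨpos : ∀ s ∈ Ioo (-b₀) b₀, ∀ s' ∈ Ioo (-g₀) g₀, 0 < Ψ s s')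
    (hF : ∀ (a : Metric n M) (β γ : OneForm n M), (∀ x, dualNorm a β x < b₀) →
      (∀ x, dualNorm a γ x < g₀) → IsFinslerMetricOn (abcMetric Ψ a β γ) (thetaRegion a β γ)) :
    ConvexityCondition n b₀ g₀ Ψ := by
  obtain ⟨a⟩ := nonempty_metric (n := n) (M := M)
  obtain ⟨x⟩ := ‹Nonempty M›
  have key : ∀ {s s' b g θ : ℝ}, Admissible n b₀ g₀ s s' b g θ →
      (n = 2 → 0 < bigGamma Ψ s s' b g θ) ∧ (b = |s| → g = |s'| → 0 < bigPi Ψ s s') ∧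
        (3 ≤ n → 0 < bigPi Ψ s s' → 0 < bigGamma Ψ s s' b g θ) := by
    intro s s' b g θ h
    obtain ⟨p, q, y, hy, hpy, hqy, hpp, hqq, hpq, himp⟩ := exists_realisation hn
      (finrank_tangentSpace x) (metricForm_symm a x) (metricForm_pos a x) Ψ h
    have hy0 : y ≠ 0 := by rintro rfl; simp at hy
    have hbb : b ^ 2 < b₀ ^ 2 :=
      pow_lt_pow_left₀ h.b_lt ((abs_nonneg s).trans h.abs_s_le) two_ne_zero
    have hgg : g ^ 2 < g₀ ^ 2 :=
      pow_lt_pow_left₀ h.g_lt ((abs_nonneg s').trans h.abs_s'_le) two_ne_zero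
    obtain ⟨β, hβx, hβ⟩ := exists_oneForm a x p hb₀ (hpp.trans_lt hbb)
    obtain ⟨γ, hγx, hγ⟩ := exists_oneForm a x q hg₀ (hqq.trans_lt hgg)
    have hα : alpha a ⟨x, y⟩ = 1 := by
      change √(metricForm a x y y) = 1
      rw [hy, Real.sqrt_one]
    have hs : ratio a β ⟨x, y⟩ = s := by rw [ratio, hα, div_one]; exact (hβx y).trans hpy
    have hs' : ratio a γ ⟨x, y⟩ = s' := by rw [ratio, hα, div_one]; exact (hγx y).trans hqy
    have hA : (⟨x, y⟩ : TangentBundle (𝓡 n) M) ∈ thetaRegion a β γ := by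
      change 0 ≤ dualInner a β γ x - ratio a β ⟨x, y⟩ * ratio a γ ⟨x, y⟩
      rw [dualInner_eq a β γ x hβx hγx, hpq, hs, hs']
      exact h.nonneg
    have hpos := (fundamentalForm_pos_iff hb₀ hg₀ hΨ hΨpos (hβ x) (hγ x) hy0).1
      ((hF a β γ hβ hγ).posDef x y hy0 hA)
    rw [hs, hs'] at hpos
    exact himp fun w hw hw0 => by simpa only [hβx, hγx] using hpos w hw hw0
  refine ⟨fun h3 s s' b g θ h => ?_, fun h2 s s' b g θ h => (key h).1 h2⟩
  -- covectors proportional to `y` give the numbers with `b = |s|`, `g = |s̄|`, `θ = s s̄`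
  have hdeg : Admissible n b₀ g₀ s s' |s| |s'| (s * s') :=
    { abs_s_le := le_rfl
      b_lt := h.abs_s_le.trans_lt h.b_lt
      abs_s'_le := le_rfl
      g_lt := h.abs_s'_le.trans_lt h.g_lt
      nonneg := by simp
      cauchy_schwarz := by simp
      eq_of_dim_two := by simp }
  have hPi := (key hdeg).2.1 rfl rfl
  exact ⟨hPi, (key h).2.2 h3 hPi⟩

end Manifold

end ABC

theorem mainTheorem1 {n : ℕ} (hn : 2 ≤ n) {M : Type*} [TopologicalSpace M] [T2Space M]
    [SecondCountableTopology M] [ChartedSpace (EuclideanSpace ℝ (Fin n)) M]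
    [IsManifold (𝓡 n) ∞ M] [Nonempty M] (b₀ g₀ : ℝ) (hb₀ : 0 < b₀) (hg₀ : 0 < g₀)
    (Ψ : ℝ → ℝ → ℝ)
    (hΨ : ContDiffOn ℝ ∞ (Function.uncurry Ψ) (Set.Ioo (-b₀) b₀ ×ˢ Set.Ioo (-g₀) g₀))
    (hΨpos : ∀ s ∈ Set.Ioo (-b₀) b₀, ∀ s' ∈ Set.Ioo (-g₀) g₀, 0 < Ψ s s') :
    ((∀ (a : ABC.Metric n M) (β γ : ABC.OneForm n M),
        (∀ x, ABC.dualNorm a β x < b₀) → (∀ x, ABC.dualNorm a γ x < g₀) →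
        ABC.IsFinslerMetricOn (ABC.abcMetric Ψ a β γ) (ABC.thetaRegion a β γ)) ↔
      ABC.ConvexityCondition n b₀ g₀ Ψ) ∧
    (ABC.ConvexityCondition n b₀ g₀ Ψ →
      ∀ (a : ABC.Metric n M) (β γ : ABC.OneForm n M),
        (∀ x, ABC.dualNorm a β x < b₀) → (∀ x, ABC.dualNorm a γ x < g₀) →
        (∀ p : TangentBundle (𝓡 n) M, p.2 ≠ 0 → p ∈ ABC.thetaRegion a β γ) →
        ABC.IsFinslerMetric (ABC.abcMetric Ψ a β γ)) := by

  have hsuff : ABC.ConvexityCondition n b₀ g₀ Ψ → ∀ (a : ABC.Metric n M) (β γ : ABC.OneForm n M),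
      (∀ x, ABC.dualNorm a β x < b₀) → (∀ x, ABC.dualNorm a γ x < g₀) →
      ABC.IsFinslerMetricOn (ABC.abcMetric Ψ a β γ) (ABC.thetaRegion a β γ) :=
    fun h a β γ hβ hγ =>
      ABC.isFinslerMetricOn_of_convexityCondition hn hb₀ hg₀ hΨ hΨpos h hβ hγ
  refine ⟨⟨ABC.convexityCondition_of_isFinslerMetricOn hn hb₀ hg₀ hΨ hΨpos, hsuff⟩,
    fun h a β γ hβ hγ hA => ?_⟩
  have hF := hsuff h a β γ hβ hγ
  exact ⟨hF.nonneg, hF.smooth, hF.homogeneous, fun x y hy _ => hF.posDef x y hy (hA ⟨x, y⟩ hy)⟩
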